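/- Let $k\ge 1$ and let $a_1,\dots,a_k,b_1,\dots,b_k$ be positive integers; put $n=\sum_{i=1}^k b_i$. Let $\Delta$ be the simplicial complex on $V_1\sqcup\dots\sqcup V_k$, where $V_i$ has $a_ib_i$ vertices, exactly $a_i$ of them labelled $t_{i,j}$ for each $1\le j\le b_i$, and where a set $\sigma$ of vertices is a simplex if and only if $|\sigma\cap V_i|\le a_i$ for all $i$. Simplices with the same multiset of labels are identified, the empty simplex is included, and $N$ is the number of simplices after identification. Let $X\subseteq\mathbb P^{N-1}_{\mathbb C}$ be the Segre–Veronese variety $v_{a_1}(\mathbb P^{b_1})\times\dots\times v_{a_k}(\mathbb P^{b_k})$, that is, the image of $\mathbb P^{b_1}\times\dots\times\mathbb P^{b_k}$ under $x_\sigma=\prod_{i=1}^k t_{i,0}^{a_i-|\sigma_i|}\prod_{j\in\sigma_i}t_{i,j}$, $\sigma\in\Delta$, where $\sigma_i$ is the multiset of labels of $\sigma$ in $V_i$. Let $\sigma_2(X)$ be its secant variety, the Zariski closure of the union of all lines spanned by two points of $X$. Let $T_\Delta$ be the Zariski closure of the image of $\mathbb C^n\ni t\mapsto\bigl(\prod_{(i,j)\in\sigma}t_{i,j}\bigr)_{\sigma}$,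 where $\sigma$ runs over the simplices with at least two elements, and let $\widehat T_\Delta$ be the affine cone over $T_\Delta$ in the same affine space, i.e. the Zariski closure of $\{s\,x : s\in\mathbb C,\ x\in T_\Delta\}$. An affine toric variety means here the Zariski closure of the image of a map $\mathbb C^m\to\mathbb C^M$ whose coordinates are distinct monomials. Then $\widehat T_\Delta$ is an affine toric variety, and it is normal (irreducible, with integrally closed coordinate ring). The product $\mathbb C^n\times\widehat T_\Delta$ is an affine toric variety, and $\sigma_2(X)$ is covered by Zariski open subsets each of which is isomorphic, as a variety, to $\mathbb C^n\times\widehat T_\Delta$. -/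

import Mathlib

open scoped LinearAlgebra.Projectivization

noncomputable section

namespace SecantToric

/-! ### Affine varieties over the complex numbers -/

/-- Zariski closure of a subset of affine space. -/
def affineClosure {κ : Type*} (S : Set (κ → ℂ)) : Set (κ → ℂ) :=
  MvPolynomial.zeroLocus ℂ (MvPolynomial.vanishingIdeal ℂ S)

/-- The coordinate ring of (the Zariski closure of) a subset of affine space. -/
abbrev CoordinateRing {κ : Type*} (Y : Set (κ → ℂ)) : Type _ :=
  MvPolynomial κ ℂ ⧸ (MvPolynomial.vanishingIdeal ℂ Y : Ideal (MvPolynomial κ ℂ))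

/-- A normal affine variety: Zariski closed, irreducible (the coordinate ring is a domain),
and with integrally closed coordinate ring. -/
structure IsNormalAffineVariety {κ : Type*} (Y : Set (κ → ℂ)) : Prop where
  closed : affineClosure Y = Y
  irreducible : IsDomain (CoordinateRing Y)
  normal : IsIntegrallyClosed (CoordinateRing Y)

/-- An affine toric variety (not necessarily normal): the Zariski closure of the image of a map
`ℂᵐ → ℂ^κ` whose coordinates are pairwise distinct monomials `t ^ c k`. -/
def IsAffineToricVariety {κ : Type*} (Y : Set (κ → ℂ)) : Prop :=
  ∃ (m : ℕ) (c : κ → Fin m → ℕ), Function.Injective c ∧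
    Y = affineClosure (Set.range fun (t : Fin m → ℂ) (k : κ) => ∏ i, t i ^ c k i)

/-- The affine cone over an affine variety `Y ⊆ ℂ^κ`, taken inside `ℂ^κ`: the Zariski closure of
the union of the lines joining the origin with the points of `Y`. -/
def affineCone {κ : Type*} (Y : Set (κ → ℂ)) : Set (κ → ℂ) :=
  affineClosure {x | ∃ s : ℂ, ∃ y ∈ Y, x = s • y}

/-- The product `ℂⁿ × Y`, as a subset of affine space. -/
def affineSpaceProd (n : ℕ) {κ : Type*} (Y : Set (κ → ℂ)) : Set (Fin n ⊕ κ → ℂ) :=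
  {z | (fun j => z (Sum.inr j)) ∈ Y}

/-! ### Projective varieties over the complex numbers -/

/-- Zariski closure of a subset of projective space. (Whether a homogeneous polynomial vanishes at
a point does not depend on the representing vector.) -/
def projClosure {ι : Type*} (S : Set (ℙ ℂ (ι → ℂ))) : Set (ℙ ℂ (ι → ℂ)) :=
  {p | ∀ (d : ℕ) (F : MvPolynomial ι ℂ), F.IsHomogeneous d →
    (∀ q ∈ S, MvPolynomial.eval q.rep F = 0) → MvPolynomial.eval p.rep F = 0}

/-- `U` is a Zariski open subset of `Z ⊆ ℙ`. -/
def IsZariskiOpenIn {ι : Type*} (U Z : Set (ℙ ℂ (ι → ℂ))) : Prop :=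
  ∃ W : Set (ℙ ℂ (ι → ℂ)), projClosure W = W ∧ U = Z \ W

/-- The secant variety: the Zariski closure of the union of the lines spanned by
two points of `X`. -/
def secantVariety {ι : Type*} (X : Set (ℙ ℂ (ι → ℂ))) : Set (ℙ ℂ (ι → ℂ)) :=
  projClosure {p | ∃ x ∈ X, ∃ y ∈ X, p.submodule ≤ x.submodule ⊔ y.submodule}

/-- A regular function on a subset `U` of projective space: locally a quotient of two homogeneous
polynomials of the same degree. -/
def IsRegularFunction {ι : Type*} (U : Set (ℙ ℂ (ι → ℂ))) (g : U → ℂ) : Prop :=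
  ∀ p : U, ∃ (d : ℕ) (F G : MvPolynomial ι ℂ), F.IsHomogeneous d ∧ G.IsHomogeneous d ∧
    MvPolynomial.eval p.1.rep G ≠ 0 ∧
    ∀ q : U, MvPolynomial.eval q.1.rep G ≠ 0 →
      g q = MvPolynomial.eval q.1.rep F / MvPolynomial.eval q.1.rep G

/-- A regular map from a subset `Y` of affine space to projective space: locally given by
homogeneous coordinates that are polynomials without common zero. -/
def IsRegularMapToProj {κ ι : Type*} (Y : Set (κ → ℂ)) (f : Y → ℙ ℂ (ι → ℂ)) : Prop :=
  ∀ y : Y, ∃ F : ι → MvPolynomial κ ℂ,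
    (fun i => MvPolynomial.eval y.1 (F i)) ≠ 0 ∧
    ∀ (z : Y) (hz : (fun i => MvPolynomial.eval z.1 (F i)) ≠ 0),
      f z = Projectivization.mk ℂ (fun i => MvPolynomial.eval z.1 (F i)) hz

/-- The quasi-projective variety `U` is isomorphic to the affine variety `Y`: there is a bijection
that is regular in both directions. -/
def IsIsomorphicToAffine {ι κ : Type*} (U : Set (ℙ ℂ (ι → ℂ))) (Y : Set (κ → ℂ)) : Prop :=
  ∃ φ : U ≃ Y, (∀ k : κ, IsRegularFunction U (fun p => (φ p).1 k)) ∧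
    IsRegularMapToProj Y (fun y => (φ.symm y).1)

/-! ### Simplicial complexes with labelled vertices and their toric varieties -/

/-- A simplicial complex (the empty simplex is allowed) with vertices in `V`, labelled by `L` with
possible repetitions. -/
structure LabelledComplex (V L : Type*) where
  faces : Set (Finset V)
  down_closed : ∀ σ ∈ faces, ∀ τ ⊆ σ, τ ∈ faces
  label : V → L

/-- The distinct simplices: simplices with the same multiset of labels are identified. -/
def LabelledComplex.simplices {V L : Type*} (Δ : LabelledComplex V L) : Set (Multiset L) :=
  {m | ∃ σ ∈ Δ.faces, m = σ.val.map Δ.label}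

/-- The simplices of dimension at least one, that is, of cardinality at least two. -/
def LabelledComplex.simplicesGeTwo {V L : Type*} (Δ : LabelledComplex V L) : Set (Multiset L) :=
  {m | m ∈ Δ.simplices ∧ 2 ≤ Multiset.card m}

/-- The affine toric variety `T_Δ`: the closure of the image of `t ↦ (∏_{i ∈ σ} t_i)_σ`, where `σ`
runs over the simplices of dimension at least one. -/
def LabelledComplex.toricVariety {V L : Type*} (Δ : LabelledComplex V L) :
    Set (Δ.simplicesGeTwo → ℂ) :=
  affineClosure (Set.range fun (t : L → ℂ) (σ : Δ.simplicesGeTwo) => (σ.1.map t).prod)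

/-! ### The Segre-Veronese variety -/

/-- The labels `(i, j)`, `1 ≤ i ≤ k`, `1 ≤ j ≤ b_i`, of the variables `t_{i,j}`. -/
abbrev SVLabel {k : ℕ} (b : Fin k → ℕ) : Type := (i : Fin k) × Fin (b i)

/-- The vertices: for every `i` and `j` there are `a_i` vertices with label `(i, j)`. -/
abbrev SVVertex {k : ℕ} (a b : Fin k → ℕ) : Type := (i : Fin k) × (Fin (b i) × Fin (a i))

/-- The complex of the Segre-Veronese variety: a set of vertices is a simplex if and only if it has
at most `a_i` elements in the `i`-th block, for every `i`. -/
def svComplex {k : ℕ} (a b : Fin k → ℕ) : LabelledComplex (SVVertex a b) (SVLabel b) where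
  faces := {σ | ∀ i, (σ.filter fun v => v.1 = i).card ≤ a i}
  down_closed := fun _ hσ _ hτ i =>
    (Finset.card_le_card (Finset.filter_subset_filter _ hτ)).trans (hσ i)
  label := fun v => ⟨v.1, v.2.1⟩

/-- The index set of the homogeneous coordinates `x_σ`. -/
abbrev SVIndex {k : ℕ} (a b : Fin k → ℕ) : Type := (svComplex a b).simplices

/-- The homogeneous coordinates
`x_σ = ∏_i t_{i,0} ^ (a_i - |σ_i|) * ∏_{j ∈ σ_i} t_{i,j}`, where `σ_i` is the part of the multiset
`σ` in the `i`-th block; `t_{i,j}` with `1 ≤ j ≤ b_i` is `t i j.succ` for `j : Fin (b i)`. -/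
def svCoord {k : ℕ} (a b : Fin k → ℕ) (t : (i : Fin k) → Fin (b i + 1) → ℂ) :
    SVIndex a b → ℂ :=
  fun σ => (∏ i, t i 0 ^ (a i - Multiset.card (σ.1.filter fun l => l.1 = i))) *
    (σ.1.map fun l => t l.1 l.2.succ).prod

/-- The Segre-Veronese variety `v_{a_1}(ℙ^{b_1}) × ⋯ × v_{a_k}(ℙ^{b_k})`, embedded by
`𝒪(a_1, …, a_k)`: the image of `∏ ℙ^{b_i}`. -/
def segreVeronese {k : ℕ} (a b : Fin k → ℕ) : Set (ℙ ℂ (SVIndex a b → ℂ)) :=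
  {p | ∃ t : (i : Fin k) → Fin (b i + 1) → ℂ, (∀ i, t i ≠ 0) ∧
    ∃ h : svCoord a b t ≠ 0, p = Projectivization.mk ℂ (svCoord a b t) h}

/-- The affine cone over `T_Δ` for the complex `Δ` of the Segre-Veronese variety. -/
def svToricCone {k : ℕ} (a b : Fin k → ℕ) : Set ((svComplex a b).simplicesGeTwo → ℂ) :=
  affineCone (svComplex a b).toricVariety

end SecantToric

end

/-!
The secant variety is described by probability. In the affine chart `x_∅ = 1` a point of the
Segre-Veronese variety has coordinates `u ^ σ`, so a point of a secant line is the vector of moments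
`𝔼[T ^ σ]` of a random vector `T` with two values. If `c` is the mean of `T`, `p` and `1 - p` are
the probabilities and `d` is the difference of the two values, the central moment of order `σ` is
`d ^ σ` times a number depending on `p` and `|σ|` only. In the parameters
`s = p (1 - p) / (1 - 2p) ^ 2` and `t = (1 - 2p) d` this central moment is
`m_{|σ|}(s) t ^ σ` for a polynomial `m_r` with zero constant term, linear coefficient one and degree
at most `r / 2` (`twoPointMoment_eq`). Since a simplex with at least `2i` elements splits into `i`
simplices with at least two elements, `s ^ i t ^ σ` is for `2 ≤ i ≤ |σ| / 2` a monomial in the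
functions `s t ^ τ` with `|τ| < |σ|`. So the moments are obtained from the means `c` and the secant
cumulants `s t ^ σ`, which are the coordinates on `ℂⁿ` times the cone over `T_Δ`, by a triangular,
hence invertible, polynomial substitution (`exists_eval_chartParam_eq`,
`exists_inverse_of_triangular`, `exists_cumulant_change`). As the moment vectors are dense in the
secant variety (`mk_mem_secantVariety_iff`), this identifies the chart `x_∅ ≠ 0` with `ℂⁿ` times the
cone. The substitutions `t_{i,0} ↦ t_{i,0} + ∑_j c_{i,j} t_{i,j}` act on the ambient space and
preserve the secant variety, and they move any given point to that chart, because the products of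
powers of linear forms span all forms of multidegree `a` (`exists_shear_emptyIndex_ne_zero`).

The coordinate ring of the cone is the algebra of the monoid of exponents generated by the `(1, σ)`.
This monoid consists of all lattice points `(d, m)` of the cone given by `|m_i| ≤ d a_i` and
`|m| ≥ 2 d` (`exists_split_block`, `mem_range_coneHom_iff`). Polynomials with exponents in a half
space are integrally closed in the polynomial ring (`weight_nonneg_of_isIntegral`), and the
polynomial ring is integrally closed, so the coordinate ring is integrally closed.
-/

noncomputable section

namespace SecantToric

open MvPolynomial

/-! ### Affine closures and toric varieties -/

section Closure

variable {κ : Type*}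

theorem eval_bind₁_eq {J : Type*} (F : J → MvPolynomial κ ℂ) (P : MvPolynomial J ℂ)
    (y : κ → ℂ) : eval y (bind₁ F P) = eval (fun j => eval y (F j)) P := by
  rw [eval, eval₂Hom_bind₁]
  rfl

theorem mem_affineClosure {S : Set (κ → ℂ)} {x : κ → ℂ} :
    x ∈ affineClosure S ↔
      ∀ f : MvPolynomial κ ℂ, (∀ y ∈ S, eval y f = 0) → eval x f = 0 := by
  simp [affineClosure, mem_zeroLocus_iff, mem_vanishingIdeal_iff, aeval_eq_eval]

theorem subset_affineClosure (S : Set (κ → ℂ)) : S ⊆ affineClosure S :=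
  fun _ hx => mem_affineClosure.2 fun _ hf => hf _ hx

theorem affineClosure_subset_affineClosure {S T : Set (κ → ℂ)} (h : S ⊆ affineClosure T) :
    affineClosure S ⊆ affineClosure T := fun _ hx =>
  mem_affineClosure.2 fun f hf => mem_affineClosure.1 hx f fun _ hy =>
    mem_affineClosure.1 (h hy) f hf

theorem affineClosure_affineClosure (S : Set (κ → ℂ)) :
    affineClosure (affineClosure S) = affineClosure S :=
  (affineClosure_subset_affineClosure subset_rfl).antisymm (subset_affineClosure _)

theorem vanishingIdeal_affineClosure (S : Set (κ → ℂ)) :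
    (vanishingIdeal ℂ (affineClosure S) : Ideal (MvPolynomial κ ℂ)) = vanishingIdeal ℂ S := by
  ext f
  simp only [mem_vanishingIdeal_iff, aeval_eq_eval]
  exact ⟨fun h x hx => h x (subset_affineClosure S hx),
    fun h x hx => mem_affineClosure.1 hx f h⟩

/-- The affine cone over a closure is the closure of the cone. -/
theorem affineCone_affineClosure (S : Set (κ → ℂ)) :
    affineCone (affineClosure S) = affineClosure {x | ∃ s : ℂ, ∃ y ∈ S, x = s • y} := by
  refine (affineClosure_subset_affineClosure ?_).antisymm (affineClosure_subset_affineClosure ?_)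
  · rintro _ ⟨s, y, hy, rfl⟩
    refine mem_affineClosure.2 fun f hf => ?_
    have key : ∀ z : κ → ℂ,
        eval z (bind₁ (fun k => C s * X k) f) = eval (s • z) f := fun z => by
      rw [eval_bind₁_eq]
      congr 2
      funext k
      simp
    rw [← key]
    refine mem_affineClosure.1 hy _ fun z hz => ?_
    rw [key]
    exact hf _ ⟨s, z, hz, rfl⟩
  · rintro _ ⟨s, y, hy, rfl⟩
    exact subset_affineClosure _ ⟨s, y, subset_affineClosure _ hy, rfl⟩

/-- Forming the product with an affine space commutes with Zariski closure. -/
theorem affineSpaceProd_affineClosure (n : ℕ) (S : Set (κ → ℂ)) :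
    affineSpaceProd n (affineClosure S) = affineClosure (affineSpaceProd n S) := by
  refine Set.Subset.antisymm (fun z hz => mem_affineClosure.2 fun f hf => ?_)
    (fun z hz => mem_affineClosure.2 fun f hf => ?_)
  · have key : ∀ y : κ → ℂ,
        eval y (bind₁ (Sum.elim (fun j => C (z (Sum.inl j))) X) f) =
          eval (Sum.elim (fun j => z (Sum.inl j)) y) f := fun y => by
      rw [eval_bind₁_eq]
      congr 2
      funext k
      cases k <;> simp
    have h2 : z = Sum.elim (fun j => z (Sum.inl j)) (fun j => z (Sum.inr j)) := by
      funext k; cases k <;> rfl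
    rw [h2, ← key]
    refine mem_affineClosure.1 hz _ fun y hy => ?_
    rw [key]
    exact hf _ hy
  · have := mem_affineClosure.1 hz (rename Sum.inr f) fun y hy => by
      rw [eval_rename]; exact hf _ hy
    rwa [eval_rename] at this

/-- The parameters of a toric variety may be indexed by any finite type. -/
theorem isAffineToricVariety_of_fintype {ι : Type*} [Fintype ι] (c : κ → ι → ℕ)
    (hc : Function.Injective c) :
    IsAffineToricVariety
      (affineClosure (Set.range fun (t : ι → ℂ) (k : κ) => ∏ i, t i ^ c k i)) := by
  let e := Fintype.equivFin ι
  refine ⟨Fintype.card ι, fun k j => c k (e.symm j), fun k k' h => hc ?_, ?_⟩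
  · funext i
    simpa using congrFun h (e i)
  · congr 1
    ext x
    constructor
    · rintro ⟨t, rfl⟩
      refine ⟨fun j => t (e.symm j), ?_⟩
      funext k
      exact (e.symm.prod_comp fun i => t i ^ c k i)
    · rintro ⟨t, rfl⟩
      refine ⟨fun i => t (e i), ?_⟩
      funext k
      change ∏ i, t (e i) ^ c k i = ∏ j, t j ^ c k (e.symm j)
      rw [← e.symm.prod_comp]
      simp

end Closure

section Cone

variable {V L : Type*} (Δ : LabelledComplex V L)

/-- The parametrization `(s, t) ↦ (s · ∏_{i ∈ σ} t_i)_σ` of the cone over `T_Δ`. -/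
def LabelledComplex.coneParam (s : ℂ) (t : L → ℂ) : Δ.simplicesGeTwo → ℂ :=
  fun σ => s * (σ.1.map t).prod

theorem LabelledComplex.affineCone_toricVariety :
    affineCone Δ.toricVariety =
      affineClosure (Set.range fun q : ℂ × (L → ℂ) => Δ.coneParam q.1 q.2) := by
  rw [LabelledComplex.toricVariety, affineCone_affineClosure]
  congr 1
  ext x
  constructor
  · rintro ⟨s, _, ⟨t, rfl⟩, rfl⟩
    exact ⟨(s, t), rfl⟩
  · rintro ⟨⟨s, t⟩, rfl⟩
    exact ⟨s, _, ⟨t, rfl⟩, rfl⟩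

theorem prod_map_eq_prod_pow_count {M L : Type*} [CommMonoid M] [Fintype L] [DecidableEq L]
    (m : Multiset L) (t : L → M) : (m.map t).prod = ∏ l, t l ^ m.count l := by
  rw [Finset.prod_multiset_map_count]
  refine Finset.prod_subset (Finset.subset_univ _) fun l _ hl => ?_
  rw [Multiset.count_eq_zero.2 fun h => hl (Multiset.mem_toFinset.2 h), pow_zero]

theorem LabelledComplex.isAffineToricVariety_cone [Fintype L] :
    IsAffineToricVariety (affineCone Δ.toricVariety) := by
  classical
  let c : Δ.simplicesGeTwo → Option L → ℕ := fun σ o => o.elim 1 fun l => σ.1.count l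
  have hc : Function.Injective c := fun σ τ h => Subtype.ext <| Multiset.ext.2 fun l =>
    congrFun h (some l)
  have := isAffineToricVariety_of_fintype c hc
  convert this using 1
  rw [Δ.affineCone_toricVariety]
  congr 1
  ext x
  constructor
  · rintro ⟨⟨s, t⟩, rfl⟩
    refine ⟨fun o => o.elim s t, ?_⟩
    funext σ
    simp [c, Fintype.prod_option, LabelledComplex.coneParam, prod_map_eq_prod_pow_count]
  · rintro ⟨t, rfl⟩
    refine ⟨(t none, fun l => t (some l)), ?_⟩
    funext σ
    simp [c, Fintype.prod_option, LabelledComplex.coneParam, prod_map_eq_prod_pow_count]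

/-- The product of an affine space with an affine toric variety is toric: the coordinates of the
affine space become additional parameters. -/
theorem IsAffineToricVariety.affineSpaceProd {κ : Type*} {Y : Set (κ → ℂ)}
    (hY : IsAffineToricVariety Y) (n : ℕ) : IsAffineToricVariety (affineSpaceProd n Y) := by
  classical
  obtain ⟨m, c, hc, rfl⟩ := hY
  let c' : Fin n ⊕ κ → Fin n ⊕ Fin m → ℕ :=
    Sum.elim (fun j => Sum.elim (Pi.single j 1) 0) (fun k => Sum.elim 0 (c k))
  have hc' : Function.Injective c' := by
    rintro (j | k) (j' | k') h
    · have := congrFun h (Sum.inl j)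
      simp only [c', Sum.elim_inl, Pi.single_apply, if_true] at this
      by_contra hne
      rw [if_neg fun h => hne (by rw [h])] at this
      exact one_ne_zero this
    · have := congrFun h (Sum.inl j)
      simp [c'] at this
    · have := congrFun h (Sum.inl j')
      simp [c'] at this
    · congr 1
      apply hc
      funext i
      exact congrFun h (Sum.inr i)
  convert isAffineToricVariety_of_fintype c' hc' using 1
  rw [affineSpaceProd_affineClosure]
  congr 1
  ext z
  constructor
  · rintro ⟨t, ht⟩
    refine ⟨Sum.elim (fun j => z (Sum.inl j)) t, ?_⟩
    funext k
    rcases k with j | k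
    · simp [c', Pi.single_apply]
    · simpa [c', Fintype.prod_sum_type] using congrFun ht k
  · rintro ⟨t, rfl⟩
    refine ⟨fun i => t (Sum.inr i), ?_⟩
    funext k
    simp [c', Fintype.prod_sum_type]

end Cone

/-! ### Polynomials of nonnegative weight -/

section HalfSpace

variable {R : Type*} [CommRing R] [IsDomain R]

/-- `R[T]` is integrally closed in `R[T;T⁻¹]` if it is integrally closed. -/
theorem laurent_mem_range_of_isIntegral [IsIntegrallyClosed (Polynomial R)]
    {y : LaurentPolynomial R} (hy : IsIntegral (Polynomial R) y) :
    ∃ p : Polynomial R, Polynomial.toLaurent p = y := by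
  let K := FractionRing (Polynomial R)
  have hX : Submonoid.powers (Polynomial.X : Polynomial R) ≤ nonZeroDivisors (Polynomial R) :=
    powers_le_nonZeroDivisors_of_noZeroDivisors Polynomial.X_ne_zero
  let g : LaurentPolynomial R →ₐ[Polynomial R] K :=
    IsLocalization.liftAlgHom (M := Submonoid.powers (Polynomial.X : Polynomial R))
      (f := Algebra.ofId (Polynomial R) K) fun y => IsLocalization.map_units K ⟨y.1, hX y.2⟩
  have hg : Function.Injective g := by
    refine (injective_iff_map_eq_zero g).2 fun x hx => ?_
    obtain ⟨⟨p, s⟩, rfl⟩ := IsLocalization.mk'_surjective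
      (Submonoid.powers (Polynomial.X : Polynomial R)) x
    have h1 := congrArg g (IsLocalization.mk'_spec (LaurentPolynomial R) p s)
    simp only [map_mul, hx, zero_mul, AlgHom.commutes] at h1
    have h2 : p = 0 := (IsFractionRing.injective (Polynomial R) K) (by rw [← h1, map_zero])
    simp [h2]
  obtain ⟨p, hp⟩ := (IsIntegrallyClosed.isIntegral_iff (K := K)).1 (hy.map g)
  refine ⟨p, hg ?_⟩
  rw [← hp, ← LaurentPolynomial.algebraMap_eq_toLaurent, AlgHom.commutes]

end HalfSpace

section Weights

variable {ι K : Type*} [Field K]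

/-- The one-parameter subgroup with weights `w`: the substitution `x_v ↦ x_v T ^ (w v)`. -/
def weightTwist (w : ι → ℤ) : MvPolynomial ι K →ₐ[K] LaurentPolynomial (MvPolynomial ι K) :=
  aeval fun v => LaurentPolynomial.C (X v) * LaurentPolynomial.T (w v)

theorem weightTwist_monomial (w : ι → ℤ) (m : ι →₀ ℕ) (a : K) :
    weightTwist w (monomial m a) =
      LaurentPolynomial.C (monomial m a) * LaurentPolynomial.T (m.sum fun v e => e * w v) := by
  have h1 : ∀ u : ι → ℤ, (m.prod fun v e => (LaurentPolynomial.T (u v) :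
      LaurentPolynomial (MvPolynomial ι K)) ^ e) =
      LaurentPolynomial.T (m.sum fun v e => e * u v) := fun u => by
    classical
    simp only [LaurentPolynomial.T_pow, Finsupp.prod, Finsupp.sum]
    induction m.support using Finset.induction_on with
    | empty => simp
    | insert v s hv ih => rw [Finset.prod_insert hv, ih, Finset.sum_insert hv,
        LaurentPolynomial.T_add]
  rw [weightTwist, aeval_monomial]
  simp only [mul_pow, Finsupp.prod_mul]
  rw [h1, ← mul_assoc]
  congr 1
  rw [monomial_eq, map_mul, Finsupp.prod, Finsupp.prod, map_prod]
  congr 1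
  exact Finset.prod_congr rfl fun v _ => (map_pow _ _ _).symm

/-- The monomials of weight `w` of a polynomial are found at `T ^ w` in its twist. -/
theorem coeff_weightTwist (w : ι → ℤ) (f : MvPolynomial ι K) (m : ι →₀ ℕ) :
    coeff m ((weightTwist w f).coeff (m.sum fun v e => e * w v)) = coeff m f := by
  classical
  induction f using MvPolynomial.induction_on' with
  | monomial u a =>
    rw [weightTwist_monomial, ← LaurentPolynomial.single_eq_C_mul_T]
    by_cases h : u = m
    · subst h
      rw [AddMonoidAlgebra.coeff_single, Finsupp.single_eq_same]
    · rw [AddMonoidAlgebra.coeff_single, Finsupp.single_apply]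
      split_ifs
      · rfl
      · simp [coeff_monomial, h]
  | add p q hp hq =>
    rw [map_add, coeff_add, ← hp, ← hq]
    simp

/-- A polynomial that is integral over a subalgebra all of whose elements have only monomials of
nonnegative weight has only monomials of nonnegative weight: the twist by the weights maps the
subalgebra to `R[T]`, which is integrally closed in `R[T;T⁻¹]`. -/
theorem weight_nonneg_of_isIntegral [Finite ι] (w : ι → ℤ) (A : Subalgebra K (MvPolynomial ι K))
    (hA : ∀ f ∈ A, ∀ m ∈ f.support, 0 ≤ m.sum fun v e => (e : ℤ) * w v)
    {f : MvPolynomial ι K} (hf : IsIntegral A f) :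
    ∀ m ∈ f.support, 0 ≤ m.sum fun v e => (e : ℤ) * w v := by
  have hmem : ∀ x : A, weightTwist w x.1 ∈
      (Polynomial.toLaurent : Polynomial (MvPolynomial ι K) →+* _).range := by
    rintro ⟨x, hx⟩
    change weightTwist w x ∈ _
    rw [x.as_sum, map_sum]
    refine Subring.sum_mem _ fun m hm => ?_
    obtain ⟨n, hn⟩ := Int.eq_ofNat_of_zero_le (hA x hx m hm)
    rw [weightTwist_monomial, hn]
    exact ⟨Polynomial.C _ * Polynomial.X ^ n, Polynomial.toLaurent_C_mul_X_pow _ _⟩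
  have hint : IsIntegral (Polynomial (MvPolynomial ι K)) (weightTwist w f) := by
    let τ : Polynomial (MvPolynomial ι K) →+* LaurentPolynomial (MvPolynomial ι K) :=
      Polynomial.toLaurent
    let e : Polynomial (MvPolynomial ι K) ≃+* τ.range :=
      RingEquiv.ofBijective τ.rangeRestrict
        ⟨fun x y h => Polynomial.toLaurent_injective (congrArg Subtype.val h),
          τ.rangeRestrict_surjective⟩
    let φ : A →+* τ.range := ((weightTwist w).toRingHom.comp A.val.toRingHom).codRestrict _ hmem
    refine hf.map_of_comp_eq (e.symm.toRingHom.comp φ) (weightTwist w).toRingHom ?_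
    ext1 x
    have h1 : τ (e.symm (φ x)) = (e (e.symm (φ x))).1 := rfl
    rw [e.apply_symm_apply] at h1
    exact h1
  obtain ⟨p, hp⟩ := laurent_mem_range_of_isIntegral hint
  intro m hm
  by_contra hneg
  rw [mem_support_iff, ← coeff_weightTwist w, ← hp] at hm
  refine hm ?_
  have h0 : m.sum (fun v e => (e : ℤ) * w v) ∉ (Polynomial.toLaurent p).coeff.support := by
    rw [LaurentPolynomial.support_coeff_toLaurent, Finset.mem_map]
    rintro ⟨n, -, hn⟩
    exact hneg (hn ▸ Int.natCast_nonneg n)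
  rw [Finsupp.notMem_support_iff.1 h0, coeff_zero]

end Weights

/-! ### Integer decomposition of the polytope of simplices -/

section Decomposition

/-- Between two integer vectors there is an integer vector with any prescribed sum between their
sums. -/
theorem exists_between_sum_eq {ι : Type*} [Fintype ι] {lo hi : ι → ℕ} (h : lo ≤ hi) {N : ℕ}
    (h1 : ∑ i, lo i ≤ N) (h2 : N ≤ ∑ i, hi i) :
    ∃ r : ι → ℕ, lo ≤ r ∧ r ≤ hi ∧ ∑ i, r i = N := by
  classical
  induction N, h1 using Nat.le_induction with
  | base => exact ⟨lo, le_rfl, h, rfl⟩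
  | succ N hN ih =>
    obtain ⟨r, hr1, hr2, hr3⟩ := ih (by omega)
    have : ∃ i, r i < hi i := by
      by_contra! hc
      have := Finset.sum_le_sum fun i (_ : i ∈ Finset.univ) => hc i
      omega
    obtain ⟨i, hi'⟩ := this
    refine ⟨r + Pi.single i 1, hr1.trans (by simp), fun j => ?_, ?_⟩
    · by_cases hj : j = i
      · subst hj; simpa using hi'
      · simpa [hj] using hr2 j
    · simp [Finset.sum_add_distrib, hr3]

/-- The integer decomposition property of the polytope
`{m ≥ 0 : |m_i| ≤ a_i, |m| ≥ 2}`: from a lattice point of its `(d + 1)`-st dilate one can split off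
a lattice point of the polytope so that the rest lies in the `d`-th dilate. -/
theorem exists_split_block {k : ℕ} {a b : Fin k → ℕ} (d : ℕ) (m : SVLabel b → ℕ)
    (h1 : ∀ i, ∑ j, m ⟨i, j⟩ ≤ (d + 1) * a i) (h2 : 2 * (d + 1) ≤ ∑ i, ∑ j, m ⟨i, j⟩) :
    ∃ τ : SVLabel b → ℕ, τ ≤ m ∧ (∀ i, ∑ j, τ ⟨i, j⟩ ≤ a i) ∧ 2 ≤ ∑ i, ∑ j, τ ⟨i, j⟩ ∧
      (∀ i, ∑ j, (m - τ) ⟨i, j⟩ ≤ d * a i) ∧ 2 * d ≤ ∑ i, ∑ j, (m - τ) ⟨i, j⟩ := by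
  set n : Fin k → ℕ := fun i => ∑ j, m ⟨i, j⟩ with hn
  -- The bounds on the size of the `i`-th block of the part split off; `n i / (d + 1)` lies between
  -- them, so there is room for a total size in the required range.
  let lo : Fin k → ℕ := fun i => n i - d * a i
  let hi : Fin k → ℕ := fun i => min (a i) (n i)
  have hlo : ∀ i, (d + 1) * lo i ≤ n i := fun i => by
    have := h1 i
    rcases le_total (n i) (d * a i) with h | h
    · simp [lo, Nat.sub_eq_zero_of_le h]
    · have h3 : (n i - d * a i) + d * a i = n i := Nat.sub_add_cancel h
      have h4 : n i - d * a i ≤ a i := by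
        change n i ≤ _ at this
        rw [add_mul] at this
        omega
      calc (d + 1) * lo i = d * (n i - d * a i) + (n i - d * a i) := by simp only [lo]; ring
        _ ≤ d * a i + (n i - d * a i) := by gcongr
        _ = n i := by omega
  have hhi : ∀ i, n i ≤ (d + 1) * hi i := fun i => by
    simp only [hi]
    rcases min_cases (a i) (n i) with h | h
    · rw [h.1]; exact h1 i
    · rw [h.1]; nlinarith
  have hlohi : lo ≤ hi := fun i =>
    le_of_mul_le_mul_left ((hlo i).trans (hhi i)) (Nat.succ_pos d)
  have hslo : (d + 1) * ∑ i, lo i ≤ ∑ i, n i := by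
    rw [Finset.mul_sum]; exact Finset.sum_le_sum fun i _ => hlo i
  have hshi : ∑ i, n i ≤ (d + 1) * ∑ i, hi i := by
    rw [Finset.mul_sum]; exact Finset.sum_le_sum fun i _ => hhi i
  change 2 * (d + 1) ≤ ∑ i, n i at h2
  have hhi2 : 2 ≤ ∑ i, hi i := by
    by_contra! hc
    have : (d + 1) * ∑ i, hi i ≤ (d + 1) * 1 := Nat.mul_le_mul_left _ (by omega)
    omega
  have hlo2 : ∑ i, lo i + 2 * d ≤ ∑ i, n i := by
    refine le_of_mul_le_mul_left ?_ (Nat.succ_pos d)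
    nlinarith
  obtain ⟨r, hr1, hr2, hr3⟩ := exists_between_sum_eq hlohi (N := max 2 (∑ i, lo i))
    (le_max_right _ _) (max_le hhi2 (Finset.sum_le_sum fun i _ => hlohi i))
  have hτ : ∀ i, ∃ τ : Fin (b i) → ℕ, τ ≤ (fun j => m ⟨i, j⟩) ∧ ∑ j, τ j = r i := fun i => by
    obtain ⟨τ, -, h, h'⟩ := exists_between_sum_eq (lo := 0) (hi := fun j => m ⟨i, j⟩) (N := r i)
      (fun _ => Nat.zero_le _) (by simp) ((hr2 i).trans (min_le_right _ _))
    exact ⟨τ, h, h'⟩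
  choose τ hτ1 hτ2 using hτ
  have hsub : ∀ i, ∑ j, (m ⟨i, j⟩ - τ i j) = n i - r i := fun i => by
    rw [← hτ2 i, hn]
    exact Finset.sum_tsub_distrib _ fun j _ => hτ1 i j
  have hrn : ∀ i, r i ≤ n i := fun i => (hr2 i).trans (min_le_right _ _)
  refine ⟨fun l => τ l.1 l.2, fun l => hτ1 l.1 l.2, fun i => ?_, ?_, fun i => ?_, ?_⟩
  · simp only [hτ2]; exact (hr2 i).trans (min_le_left _ _)
  · simp only [hτ2, hr3]; exact le_max_left _ _
  · simp only [Pi.sub_apply, hsub]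
    have := hr1 i
    simp only [lo] at this
    omega
  · simp only [Pi.sub_apply, hsub]
    rw [Finset.sum_tsub_distrib _ fun i _ => hrn i, hr3]
    omega

end Decomposition

/-! ### Simplices as multisets of labels -/

section Faces

variable {k : ℕ} {a b : Fin k → ℕ}

theorem card_filter_block (m : Multiset (SVLabel b)) (i : Fin k) :
    Multiset.card (m.filter fun l => l.1 = i) = ∑ j, m.count ⟨i, j⟩ := by
  induction m using Multiset.induction_on with
  | empty => simp
  | cons l m ih =>
    simp only [Multiset.count_cons, Finset.sum_add_distrib, ← ih]
    obtain ⟨i', j'⟩ := l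
    by_cases h : i' = i
    · subst h
      simp
    · have h' : ∀ j, ¬ ((⟨i, j⟩ : SVLabel b) = ⟨i', j'⟩) := fun j hj =>
        h (congrArg Sigma.fst hj).symm
      simp [h, h']

theorem card_eq_sum_blocks (m : Multiset (SVLabel b)) :
    Multiset.card m = ∑ i, ∑ j, m.count ⟨i, j⟩ := by
  rw [← Fintype.sum_sigma' fun i j => m.count ⟨i, j⟩]
  simp

/-- A multiset of labels is a simplex if and only if it has at most `a_i` labels in the `i`-th
block; repeated labels are realized by distinct vertices. -/
theorem mem_simplices_iff (m : Multiset (SVLabel b)) :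
    m ∈ (svComplex a b).simplices ↔
      ∀ i, Multiset.card (m.filter fun l => l.1 = i) ≤ a i := by
  constructor
  · rintro ⟨σ, hσ, rfl⟩ i
    rw [Multiset.filter_map, Multiset.card_map]
    exact hσ i
  · intro h
    have hc : ∀ l : SVLabel b, m.count l ≤ a l.1 := fun l => by
      refine le_trans ?_ (h l.1)
      rw [card_filter_block]
      exact Finset.single_le_sum (f := fun j => m.count ⟨l.1, j⟩) (fun _ _ => Nat.zero_le _)
        (Finset.mem_univ l.2)
    let σ : Finset (SVVertex a b) :=
      Finset.univ.filter fun v => v.2.2.1 < m.count ⟨v.1, v.2.1⟩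
    have hσ : σ.val.map (svComplex a b).label = m := by
      ext l
      obtain ⟨i, j⟩ := l
      rw [Multiset.count_map]
      change (Finset.card (σ.filter fun v => (⟨i, j⟩ : SVLabel b) = ⟨v.1, v.2.1⟩)) = _
      rw [show σ.filter (fun v => (⟨i, j⟩ : SVLabel b) = ⟨v.1, v.2.1⟩) =
        (Finset.univ.filter fun r : Fin (a i) => r.1 < m.count ⟨i, j⟩).map
          ⟨fun r => (⟨i, (j, r)⟩ : SVVertex a b), fun r r' h => by simpa using h⟩ from ?_]
      · rw [Finset.card_map, Fin.card_filter_val_lt]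
        exact min_eq_right (hc ⟨i, j⟩)
      · ext ⟨i', j', r⟩
        simp only [σ, Finset.mem_filter, Finset.mem_univ, true_and, Finset.mem_map]
        constructor
        · rintro ⟨h1, h2⟩
          cases h2
          exact ⟨r, h1, rfl⟩
        · rintro ⟨r', h1, h2⟩
          cases h2
          exact ⟨h1, rfl⟩
    refine ⟨σ, fun i => ?_, hσ.symm⟩
    have := h i
    rw [← hσ, Multiset.filter_map, Multiset.card_map] at this
    exact this

theorem mem_simplices_of_le {m m' : Multiset (SVLabel b)} (h : m' ≤ m)
    (hm : m ∈ (svComplex a b).simplices) : m' ∈ (svComplex a b).simplices :=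
  (mem_simplices_iff _).2 fun i =>
    (Multiset.card_le_card (Multiset.filter_le_filter _ h)).trans ((mem_simplices_iff _).1 hm i)

instance finite_simplices : Finite (svComplex a b).simplices := by
  have : (svComplex a b).simplices =
      (fun σ : Finset (SVVertex a b) => σ.val.map (svComplex a b).label) ''
        (svComplex a b).faces := by
    ext m
    exact ⟨fun ⟨σ, h, e⟩ => ⟨σ, h, e.symm⟩, fun ⟨σ, h, e⟩ => ⟨σ, h, e.symm⟩⟩
  rw [this]
  exact Set.Finite.to_subtype ((Set.toFinite _).image _)

instance finite_simplicesGeTwo : Finite (svComplex a b).simplicesGeTwo :=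
  Set.Finite.to_subtype ((Set.toFinite (svComplex a b).simplices).subset fun _ h => h.1)

end Faces

/-! ### The coordinate ring of the cone -/

section ConeRing

/-- The exponent of the monomial `s · ∏_{l ∈ m} t_l`, where `s` is the variable `none`. -/
def coneExponent {L : Type*} [Fintype L] [DecidableEq L] (m : Multiset L) : Option L →₀ ℕ :=
  Finsupp.equivFunOnFinite.symm fun o => o.elim 1 fun l => m.count l

theorem eval_monomial_coneExponent {L : Type*} [Fintype L] [DecidableEq L] (m : Multiset L)
    (y : Option L → ℂ) :
    eval y (monomial (coneExponent m) 1) = y none * (m.map fun l => y (some l)).prod := by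
  rw [eval_monomial, Finsupp.prod_fintype _ _ (by simp), Fintype.prod_option,
    prod_map_eq_prod_pow_count]
  simp [coneExponent]

/-- The polynomials all of whose monomials have nonnegative weight. -/
def halfSpaceSubalgebra {ι : Type*} (w : ι → ℤ) : Subalgebra ℂ (MvPolynomial ι ℂ) where
  carrier := {f | ∀ m ∈ f.support, 0 ≤ m.sum fun v e => (e : ℤ) * w v}
  mul_mem' {f g} hf hg m hm := by
    classical
    obtain ⟨u, hu, v, hv, rfl⟩ := Finset.mem_add.1 (support_mul f g hm)
    rw [Finsupp.sum_add_index' (by simp) (by intros; push_cast; ring)]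
    exact add_nonneg (hf u hu) (hg v hv)
  add_mem' {f g} hf hg m hm := by
    classical
    rcases Finset.mem_union.1 (support_add hm) with h | h
    exacts [hf m h, hg m h]
  algebraMap_mem' c m hm := by
    classical
    rw [algebraMap_eq, mem_support_iff, coeff_C] at hm
    have : m = 0 := by
      by_contra h
      exact hm (if_neg (Ne.symm h))
    simp [this]

variable {k : ℕ} (a b : Fin k → ℕ)

/-- The pull-back of polynomial functions along the parametrization of the cone. -/
def coneHom : MvPolynomial (svComplex a b).simplicesGeTwo ℂ →ₐ[ℂ]
    MvPolynomial (Option (SVLabel b)) ℂ :=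
  aeval fun σ => monomial (coneExponent σ.1) 1

variable {a b}

theorem eval_coneHom (f : MvPolynomial (svComplex a b).simplicesGeTwo ℂ)
    (y : Option (SVLabel b) → ℂ) :
    eval y (coneHom a b f) =
      eval ((svComplex a b).coneParam (y none) fun l => y (some l)) f := by
  change eval y (bind₁ _ f) = _
  rw [eval_bind₁_eq]
  congr 2
  funext σ
  exact eval_monomial_coneExponent σ.1 y

theorem vanishingIdeal_svToricCone :
    (vanishingIdeal ℂ (svToricCone a b) : Ideal (MvPolynomial _ ℂ)) =
      RingHom.ker (coneHom a b) := by
  rw [svToricCone, LabelledComplex.affineCone_toricVariety, vanishingIdeal_affineClosure]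
  ext f
  rw [mem_vanishingIdeal_iff, RingHom.mem_ker]
  constructor
  · intro h
    refine MvPolynomial.funext fun y => ?_
    rw [eval_coneHom, map_zero]
    exact h _ ⟨(y none, fun l => y (some l)), rfl⟩
  · rintro h _ ⟨⟨s, t⟩, rfl⟩
    have := eval_coneHom f fun o => o.elim s t
    rw [h, map_zero] at this
    exact this.symm

/-- The linear form `d a_i - |m_i|` on exponents `(d, m)`. -/
def blockWeight (a b : Fin k → ℕ) (i : Fin k) : Option (SVLabel b) → ℤ
  | none => a i
  | some l => if l.1 = i then -1 else 0

/-- The linear form `|m| - 2 d` on exponents `(d, m)`. -/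
def sizeWeight (b : Fin k → ℕ) : Option (SVLabel b) → ℤ
  | none => -2
  | some _ => 1

theorem sum_blockWeight (i : Fin k) (m : Option (SVLabel b) →₀ ℕ) :
    (m.sum fun v e => (e : ℤ) * blockWeight a b i v) =
      (m none : ℤ) * a i - ∑ j, (m (some ⟨i, j⟩) : ℤ) := by
  rw [Finsupp.sum_fintype _ _ (by simp), Fintype.sum_option, Fintype.sum_sigma,
    Finset.sum_eq_single i]
  · simp [blockWeight, sub_eq_add_neg]
  · intro i' _ hi'
    simp [blockWeight, hi']
  · simp

theorem sum_sizeWeight (m : Option (SVLabel b) →₀ ℕ) :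
    (m.sum fun v e => (e : ℤ) * sizeWeight b v) =
      (∑ i, ∑ j, (m (some ⟨i, j⟩) : ℤ)) - 2 * m none := by
  rw [Finsupp.sum_fintype _ _ (by simp), Fintype.sum_option, Fintype.sum_sigma]
  simp only [sizeWeight, mul_one]
  ring

theorem range_coneHom_le_blockWeight (i : Fin k) :
    (coneHom a b).range ≤ halfSpaceSubalgebra (blockWeight a b i) := by
  classical
  rw [coneHom, ← Algebra.adjoin_range_eq_range_aeval]
  refine Algebra.adjoin_le ?_
  rintro _ ⟨σ, rfl⟩ m hm
  rw [Finset.mem_singleton.1 (support_monomial_subset hm), sum_blockWeight]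
  have := (mem_simplices_iff _).1 σ.2.1 i
  rw [card_filter_block] at this
  simp only [coneExponent, Finsupp.equivFunOnFinite_symm_apply_apply, Option.elim]
  push_cast
  have h2 : ((∑ j, σ.1.count ⟨i, j⟩ : ℕ) : ℤ) ≤ a i := by exact_mod_cast this
  push_cast at h2
  linarith

theorem range_coneHom_le_sizeWeight :
    (coneHom a b).range ≤ halfSpaceSubalgebra (sizeWeight b) := by
  classical
  rw [coneHom, ← Algebra.adjoin_range_eq_range_aeval]
  refine Algebra.adjoin_le ?_
  rintro _ ⟨σ, rfl⟩ m hm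
  rw [Finset.mem_singleton.1 (support_monomial_subset hm), sum_sizeWeight]
  have := σ.2.2
  rw [card_eq_sum_blocks] at this
  simp only [coneExponent, Finsupp.equivFunOnFinite_symm_apply_apply, Option.elim]
  have h2 : (2 : ℤ) ≤ ((∑ i, ∑ j, σ.1.count ⟨i, j⟩ : ℕ) : ℤ) := by exact_mod_cast this
  push_cast at h2 ⊢
  linarith

/-- Every lattice point of the cone is the exponent of a monomial in the ring of the cone. -/
theorem monomial_mem_range_coneHom (d : ℕ) (m : Option (SVLabel b) →₀ ℕ) (hd : m none = d)
    (h1 : ∀ i, ∑ j, m (some ⟨i, j⟩) ≤ d * a i)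
    (h2 : 2 * d ≤ ∑ i, ∑ j, m (some ⟨i, j⟩)) :
    monomial m (1 : ℂ) ∈ (coneHom a b).range := by
  classical
  induction d generalizing m with
  | zero =>
    have : m = 0 := by
      ext o
      rcases o with _ | ⟨i, j⟩
      · exact hd
      · have := h1 i
        rw [zero_mul, Nat.le_zero, Finset.sum_eq_zero_iff] at this
        exact this j (Finset.mem_univ j)
    rw [this]
    exact one_mem _
  | succ d ih =>
    obtain ⟨τ, hτm, hτ1, hτ2, hr1, hr2⟩ := exists_split_block d (fun l => m (some l)) h1 h2
    let σ : Multiset (SVLabel b) := Finsupp.toMultiset (Finsupp.equivFunOnFinite.symm τ)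
    have hcount : ∀ l, σ.count l = τ l := fun l => by simp [σ, Finsupp.count_toMultiset]
    have hσ : σ ∈ (svComplex a b).simplicesGeTwo := by
      refine ⟨(mem_simplices_iff _).2 fun i => ?_, ?_⟩
      · simpa only [card_filter_block, hcount] using hτ1 i
      · simpa only [card_eq_sum_blocks, hcount] using hτ2
    have hle : coneExponent σ ≤ m := by
      intro o
      rcases o with _ | l
      · simp [coneExponent, hd]
      · simpa [coneExponent, hcount] using hτm l
    have hsub : ∀ l, (m - coneExponent σ) (some l) = m (some l) - τ l := fun l => by
      simp [coneExponent, hcount]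
    have hrest := ih (m - coneExponent σ) (by simp [coneExponent, hd])
      (fun i => by simpa only [hsub, Pi.sub_apply] using hr1 i)
      (by simpa only [hsub, Pi.sub_apply] using hr2)
    have hface : monomial (coneExponent σ) (1 : ℂ) ∈ (coneHom a b).range :=
      ⟨X ⟨σ, hσ⟩, by simp [coneHom]⟩
    have := mul_mem hface hrest
    rwa [monomial_mul, one_mul, add_tsub_cancel_of_le hle] at this

theorem mem_range_coneHom_iff (f : MvPolynomial (Option (SVLabel b)) ℂ) :
    f ∈ (coneHom a b).range ↔
      (∀ i, f ∈ halfSpaceSubalgebra (blockWeight a b i)) ∧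
        f ∈ halfSpaceSubalgebra (sizeWeight b) := by
  refine ⟨fun h => ⟨fun i => range_coneHom_le_blockWeight i h, range_coneHom_le_sizeWeight h⟩,
    fun ⟨h1, h2⟩ => ?_⟩
  rw [f.as_sum]
  refine sum_mem fun m hm => ?_
  have h3 : monomial m (1 : ℂ) ∈ (coneHom a b).range := by
    refine monomial_mem_range_coneHom (m none) m rfl (fun i => ?_) ?_
    · have := h1 i m hm
      rw [sum_blockWeight] at this
      zify
      linarith
    · have := h2 m hm
      rw [sum_sizeWeight] at this
      zify
      linarith
  have := (coneHom a b).range.smul_mem h3 (coeff m f)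
  rwa [smul_monomial, smul_eq_mul, mul_one] at this

theorem isIntegrallyClosed_range_coneHom : IsIntegrallyClosed (coneHom a b).range := by
  have : IsIntegrallyClosedIn (coneHom a b).range (MvPolynomial (Option (SVLabel b)) ℂ) := by
    rw [isIntegrallyClosedIn_iff]
    refine ⟨Subtype.val_injective, fun {f} hf => ?_⟩
    refine ⟨⟨f, (mem_range_coneHom_iff f).2 ⟨fun i => ?_, ?_⟩⟩, rfl⟩
    · exact weight_nonneg_of_isIntegral _ _ (fun g hg => range_coneHom_le_blockWeight i hg) hf
    · exact weight_nonneg_of_isIntegral _ _ (fun g hg => range_coneHom_le_sizeWeight hg) hf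
  exact IsIntegrallyClosed.of_isIntegrallyClosed_of_isIntegrallyClosedIn _
    (MvPolynomial (Option (SVLabel b)) ℂ)

theorem isNormalAffineVariety_svToricCone (a b : Fin k → ℕ) :
    IsNormalAffineVariety (svToricCone a b) := by
  let e : CoordinateRing (svToricCone a b) ≃+* (coneHom a b).range :=
    (Ideal.quotEquivOfEq vanishingIdeal_svToricCone).trans
      (RingHom.quotientKerEquivRange (coneHom a b).toRingHom)
  refine ⟨?_, ?_, ?_⟩
  · rw [svToricCone, affineCone, affineClosure_affineClosure]
  · exact e.toMulEquiv.isDomain _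
  · have := isIntegrallyClosed_range_coneHom (a := a) (b := b)
    exact IsIntegrallyClosed.of_equiv e.symm

end ConeRing

/-! ### Triangular polynomial automorphisms -/

section Triangular

variable {J : Type*}

theorem eval_congr_of_mem_supported {s : Set J} {P : MvPolynomial J ℂ}
    (hP : P ∈ supported ℂ s) {x y : J → ℂ} (h : ∀ i ∈ s, x i = y i) : eval x P = eval y P :=
  eval₂Hom_congr' rfl (fun i hi _ => h i (mem_supported.1 hP hi)) rfl

/-- A polynomial self-map of affine space of the form `y_j = x_j + Q_j`, where `Q_j` involves only
variables of rank smaller than that of `j`, has a polynomial inverse. -/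
theorem exists_inverse_of_triangular [Finite J] (rank : J → ℕ) (Q : J → MvPolynomial J ℂ)
    (hQ : ∀ j, Q j ∈ supported ℂ {i | rank i < rank j}) :
    ∃ Φ : J → MvPolynomial J ℂ, ∀ x y : J → ℂ,
      (∀ j, y j = x j + eval x (Q j)) ↔ ∀ j, x j = eval y (Φ j) := by
  -- Solve for the variables by fixed-point iteration, which stabilizes rank by rank.
  let Φ : ℕ → J → MvPolynomial J ℂ := fun N =>
    Nat.rec X (fun _ F j => X j - bind₁ F (Q j)) N
  have hΦ : ∀ N j (y : J → ℂ), eval y (Φ (N + 1) j) =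
      y j - eval (fun i => eval y (Φ N i)) (Q j) := fun N j y => by
    rw [← eval_bind₁_eq]
    simp [Φ]
  have hstab : ∀ N j (y : J → ℂ), rank j < N → eval y (Φ (N + 1) j) = eval y (Φ N j) := by
    intro N
    induction N with
    | zero => intro j y hj; omega
    | succ N ih =>
      intro j y hj
      rw [hΦ (N + 1), hΦ N]
      congr 1
      refine eval_congr_of_mem_supported (hQ j) fun i hi => ih i y ?_
      have : rank i < rank j := hi
      omega
  obtain ⟨N, hN⟩ : ∃ N, ∀ j, rank j < N := by
    obtain ⟨M, hM⟩ := (Set.finite_range rank).bddAbove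
    exact ⟨M + 1, fun j => Nat.lt_succ_of_le (hM ⟨j, rfl⟩)⟩
  have hfix : ∀ j (y : J → ℂ), eval y (Φ N j) = y j - eval (fun i => eval y (Φ N i)) (Q j) :=
    fun j y => by rw [← hΦ, hstab N j y (hN j)]
  refine ⟨Φ N, fun x y => ⟨fun h => ?_, fun h j => ?_⟩⟩
  · have : ∀ r j, rank j < r → x j = eval y (Φ N j) := by
      intro r
      induction r with
      | zero => intro j hj; omega
      | succ r ih =>
        intro j hj
        rw [hfix, h j, eval_congr_of_mem_supported (hQ j) (y := fun i => eval y (Φ N i))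
          fun i hi => ih i ?_]
        · ring
        · have : rank i < rank j := hi
          omega
    exact fun j => this N j (hN j)
  · obtain rfl : x = fun i => eval y (Φ N i) := funext h
    have := hfix j y
    linear_combination -this

end Triangular

/-! ### Closures in projective space -/

section Projective

variable {ι : Type*}

theorem eval_smul_of_isHomogeneous {F : MvPolynomial ι ℂ} {d : ℕ} (hF : F.IsHomogeneous d)
    (r : ℂ) (v : ι → ℂ) : eval (r • v) F = r ^ d * eval v F := by
  rw [eval_eq, eval_eq, Finset.mul_sum]
  refine Finset.sum_congr rfl fun m hm => ?_
  have hd : ∑ i ∈ m.support, m i = d := by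
    have := hF (mem_support_iff.1 hm)
    simpa [Finsupp.weight_apply, Finsupp.sum] using this
  simp only [Pi.smul_apply, smul_eq_mul, mul_pow, Finset.prod_mul_distrib,
    Finset.prod_pow_eq_pow_sum, hd]
  ring

theorem eval_mk_rep_eq_zero {F : MvPolynomial ι ℂ} {d : ℕ} (hF : F.IsHomogeneous d)
    {v : ι → ℂ} (hv : v ≠ 0) :
    eval (Projectivization.mk ℂ v hv).rep F = 0 ↔ eval v F = 0 := by
  obtain ⟨r, hr⟩ := Projectivization.exists_smul_eq_mk_rep ℂ v hv
  rw [← hr, Units.smul_def, eval_smul_of_isHomogeneous hF]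
  simp

theorem mk_mem_projClosure {S : Set (ℙ ℂ (ι → ℂ))} {v : ι → ℂ} (hv : v ≠ 0) :
    Projectivization.mk ℂ v hv ∈ projClosure S ↔
      ∀ (d : ℕ) (F : MvPolynomial ι ℂ), F.IsHomogeneous d →
        (∀ q ∈ S, eval q.rep F = 0) → eval v F = 0 :=
  forall_congr' fun _ => forall_congr' fun _ => forall_congr' fun hF => by
    rw [eval_mk_rep_eq_zero hF]

theorem subset_projClosure (S : Set (ℙ ℂ (ι → ℂ))) : S ⊆ projClosure S :=
  fun _ hp _ _ _ h => h _ hp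

/-- The part of a closed set where a homogeneous polynomial does not vanish is open. -/
theorem isZariskiOpenIn_ne_zero {Z : Set (ℙ ℂ (ι → ℂ))} {F : MvPolynomial ι ℂ} {d : ℕ}
    (hF : F.IsHomogeneous d) : IsZariskiOpenIn {p | p ∈ Z ∧ eval p.rep F ≠ 0} Z := by
  refine ⟨{p | eval p.rep F = 0}, Set.Subset.antisymm ?_ (subset_projClosure _), ?_⟩
  · exact fun p hp => hp d F hF fun q hq => hq
  · ext p
    simp

/-- Homogenization: a polynomial in quotients `ℓ_j / G` of linear forms is a quotient of a
homogeneous polynomial by a power of `G`. -/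
theorem exists_homogenization {J : Type*} (P : MvPolynomial J ℂ) (ℓ : J → MvPolynomial ι ℂ)
    (hℓ : ∀ j, (ℓ j).IsHomogeneous 1) (G : MvPolynomial ι ℂ) (hG : G.IsHomogeneous 1) :
    ∃ (d : ℕ) (F : MvPolynomial ι ℂ), F.IsHomogeneous d ∧ ∀ x, eval x G ≠ 0 →
      eval x F = eval x G ^ d * eval (fun j => eval x (ℓ j) / eval x G) P := by
  induction P using MvPolynomial.induction_on with
  | C c => exact ⟨0, C c, isHomogeneous_C _ _, by simp⟩
  | add p q hp hq =>
    obtain ⟨d, F, hF, h⟩ := hp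
    obtain ⟨d', F', hF', h'⟩ := hq
    refine ⟨d + d', F * G ^ d' + F' * G ^ d, (hF.mul ?_).add ?_, fun x hx => ?_⟩
    · simpa using hG.pow d'
    · rw [add_comm d d']
      exact hF'.mul (by simpa using hG.pow d)
    · simp only [map_add, map_mul, map_pow, h x hx, h' x hx]
      ring
  | mul_X p j hp =>
    obtain ⟨d, F, hF, h⟩ := hp
    refine ⟨d + 1, F * ℓ j, hF.mul (hℓ j), fun x hx => ?_⟩
    simp only [map_mul, eval_X, h x hx]
    field_simp
    ring

end Projective

/-! ### Density arguments -/

/-- A continuous function of one complex variable that vanishes outside a finite set vanishes. -/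
theorem eq_zero_of_forall_notMem_finite {f : ℂ → ℂ} (hf : Continuous f) {s : Set ℂ}
    (hs : s.Finite) (h : ∀ z ∉ s, f z = 0) (z : ℂ) : f z = 0 :=
  congrFun (hf.ext_on (hs.countable.dense_compl ℂ) continuous_const h) z

/-! ### Secant cumulants -/

/-- The central moments of a two-point distribution, normalized: for the law taking the values
`-p` and `1 - p` with probabilities `1 - p` and `p`, the `r`-th moment is
`(1 - 2p) ^ r` times the value of this polynomial at `s = p (1 - p) / (1 - 2p) ^ 2`. -/
def momentPoly : ℕ → Polynomial ℂ
  | 0 => 1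
  | 1 => 0
  | r + 2 => momentPoly (r + 1) + Polynomial.X * momentPoly r

theorem coeff_zero_momentPoly (r : ℕ) : (momentPoly (r + 1)).coeff 0 = 0 := by
  induction r with
  | zero => simp [momentPoly]
  | succ r ih => simp [momentPoly, ih]

theorem coeff_one_momentPoly (r : ℕ) : (momentPoly (r + 2)).coeff 1 = 1 := by
  induction r with
  | zero => simp [momentPoly]
  | succ r ih =>
    rw [momentPoly, Polynomial.coeff_add, ih, Polynomial.coeff_X_mul, coeff_zero_momentPoly,
      add_zero]

theorem natDegree_momentPoly_le (r : ℕ) : (momentPoly r).natDegree ≤ r / 2 := by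
  induction r using Nat.twoStepInduction with
  | zero => simp [momentPoly]
  | one => simp [momentPoly]
  | more r ih0 ih1 =>
    rw [momentPoly]
    refine (Polynomial.natDegree_add_le _ _).trans (max_le (ih1.trans (by omega)) ?_)
    refine Polynomial.natDegree_mul_le.trans ?_
    have := Polynomial.natDegree_X_le (R := ℂ)
    omega

/-- Both sides satisfy the linear recursion with characteristic roots `-p` and `1 - p`, whose sum is
`e` and whose product is `-s e ^ 2`. -/
theorem twoPoint_moment_eq {p e s : ℂ} (he : e = 1 - 2 * p) (hs : s * e ^ 2 = p * (1 - p))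
    (r : ℕ) : (1 - p) * (-p) ^ r + p * (1 - p) ^ r = e ^ r * (momentPoly r).eval s := by
  induction r using Nat.twoStepInduction with
  | zero => simp [momentPoly]
  | one => simp [momentPoly]; ring
  | more r ih0 ih1 =>
    simp only [momentPoly, Polynomial.eval_add, Polynomial.eval_mul, Polynomial.eval_X]
    have h : e ^ (r + 2) * ((momentPoly (r + 1)).eval s + s * (momentPoly r).eval s) =
        e * (e ^ (r + 1) * (momentPoly (r + 1)).eval s) +
          s * e ^ 2 * (e ^ r * (momentPoly r).eval s) := by ring
    rw [h, ← ih0, ← ih1, hs, he]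
    ring

/-- The moments `𝔼[∏_{l ∈ σ} T_l]` of a two-point law with mean `c` in the parameters `s`, `t` of
secant cumulants. -/
def twoPointMoment {L : Type*} (c : L → ℂ) (s : ℂ) (t : L → ℂ) (σ : Multiset L) : ℂ :=
  (σ.antidiagonal.map fun q =>
    (q.1.map c).prod * ((momentPoly (Multiset.card q.2)).eval s * (q.2.map t).prod)).sum

theorem twoPointMoment_zero {L : Type*} (c : L → ℂ) (s : ℂ) (t : L → ℂ) :
    twoPointMoment c s t 0 = 1 := by
  simp [twoPointMoment, momentPoly]

theorem twoPointMoment_singleton {L : Type*} (c : L → ℂ) (s : ℂ) (t : L → ℂ) (l : L) :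
    twoPointMoment c s t {l} = c l := by
  rw [← Multiset.cons_zero, twoPointMoment, Multiset.antidiagonal_cons]
  simp [momentPoly]

/-- The moments of the law taking the values `c - p d` and `c + (1 - p) d` with probabilities
`1 - p` and `p`. -/
theorem twoPointMoment_eq {L : Type*} (c d : L → ℂ) {p e s : ℂ} (he : e = 1 - 2 * p)
    (hs : s * e ^ 2 = p * (1 - p)) (σ : Multiset L) :
    twoPointMoment c s (fun l => e * d l) σ =
      (1 - p) * (σ.map fun l => c l + -p * d l).prod +
        p * (σ.map fun l => c l + (1 - p) * d l).prod := by
  rw [Multiset.prod_map_add, Multiset.prod_map_add, twoPointMoment,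
    ← Multiset.sum_map_mul_left, ← Multiset.sum_map_mul_left, ← Multiset.sum_map_add]
  congr 1
  refine Multiset.map_congr rfl fun q _ => ?_
  simp only [Multiset.prod_map_mul, Multiset.map_const', Multiset.prod_replicate]
  linear_combination -((q.1.map c).prod * (q.2.map d).prod) *
    twoPoint_moment_eq he hs (Multiset.card q.2)

/-- The splitting of `σ` with empty first part occurs only once among all splittings. -/
theorem exists_antidiagonal_eq_cons {L : Type*} (σ : Multiset L) :
    ∃ rest : Multiset (Multiset L × Multiset L), σ.antidiagonal = (0, σ) ::ₘ rest ∧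
      ∀ q ∈ rest, Multiset.card q.2 < Multiset.card σ := by
  induction σ using Multiset.induction_on with
  | empty => exact ⟨0, by simp, by simp⟩
  | cons l σ ih =>
    obtain ⟨rest, h1, h2⟩ := ih
    refine ⟨rest.map (Prod.map id (Multiset.cons l)) +
      σ.antidiagonal.map (Prod.map (Multiset.cons l) id), ?_, fun q hq => ?_⟩
    · rw [Multiset.antidiagonal_cons, h1]
      simp [Multiset.cons_swap]
    · rcases Multiset.mem_add.1 hq with hq | hq
      · obtain ⟨q', hq', rfl⟩ := Multiset.mem_map.1 hq
        simpa using h2 q' hq'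
      · obtain ⟨q', hq', rfl⟩ := Multiset.mem_map.1 hq
        rw [Multiset.mem_antidiagonal] at hq'
        simp [← hq']

section Cumulants

variable {k : ℕ} {a b : Fin k → ℕ}

theorem exists_le_card_eq_two {L : Type*} {ρ : Multiset L} (h : 2 ≤ Multiset.card ρ) :
    ∃ τ ≤ ρ, Multiset.card τ = 2 := by
  have : 0 < Multiset.card (Multiset.powersetCard 2 ρ) := by
    rw [Multiset.card_powersetCard]
    exact Nat.choose_pos h
  obtain ⟨τ, hτ⟩ := Multiset.card_pos_iff_exists_mem.1 this
  exact ⟨τ, Multiset.mem_powersetCard.1 hτ⟩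

/-- On the cone over `T_Δ` the function `s ^ (i + 1) t ^ ρ` is a monomial in the coordinates: split
`ρ` into `i + 1` simplices of cardinality at least two. -/
theorem exists_eval_coneParam_eq_pow (i : ℕ) (ρ : Multiset (SVLabel b))
    (hρ : ρ ∈ (svComplex a b).simplices) (hi : 2 * (i + 1) ≤ Multiset.card ρ) :
    ∃ M ∈ supported ℂ {σ : (svComplex a b).simplicesGeTwo |
        Multiset.card σ.1 ≤ Multiset.card ρ - 2 * i},
      ∀ s t, eval ((svComplex a b).coneParam s t) M = s ^ (i + 1) * (ρ.map t).prod := by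
  induction i generalizing ρ with
  | zero =>
    exact ⟨X ⟨ρ, hρ, by omega⟩, X_mem_supported.2 (by simp),
      fun s t => by simp [LabelledComplex.coneParam]⟩
  | succ i ih =>
    obtain ⟨τ, hτ, hτ2⟩ := exists_le_card_eq_two (ρ := ρ) (by omega)
    obtain ⟨ρ', rfl⟩ := Multiset.le_iff_exists_add.1 hτ
    rw [Multiset.card_add, hτ2] at hi ⊢
    obtain ⟨M, hM, hM'⟩ := ih ρ' (mem_simplices_of_le (Multiset.le_add_left _ _) hρ) (by omega)
    refine ⟨X ⟨τ, mem_simplices_of_le hτ hρ, hτ2.ge⟩ * M,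
      mul_mem (X_mem_supported.2 ?_) (supported_mono (fun σ hσ => ?_) hM), fun s t => ?_⟩
    · simp only [Set.mem_ofPred_eq, hτ2]
      omega
    · simp only [Set.mem_ofPred_eq] at hσ ⊢
      omega
    · rw [map_mul, hM', eval_X, LabelledComplex.coneParam, Multiset.map_add, Multiset.prod_add]
      ring

/-- On the cone over `T_Δ` the central moments are polynomials in the coordinates, the coordinate
`ρ` appearing with coefficient one and only smaller simplices appearing otherwise. -/
theorem exists_eval_coneParam_eq_moment (ρ : (svComplex a b).simplicesGeTwo) :
    ∃ N ∈ supported ℂ {σ : (svComplex a b).simplicesGeTwo |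
        Multiset.card σ.1 < Multiset.card ρ.1},
      ∀ s t, eval ((svComplex a b).coneParam s t) (X ρ + N) =
        (momentPoly (Multiset.card ρ.1)).eval s * (ρ.1.map t).prod := by
  obtain ⟨r, hr⟩ : ∃ r, Multiset.card ρ.1 = r + 2 := ⟨_, (Nat.sub_add_cancel ρ.2.2).symm⟩
  have hM : ∀ i : Fin (r / 2), ∃ M ∈ supported ℂ {σ : (svComplex a b).simplicesGeTwo |
      Multiset.card σ.1 < Multiset.card ρ.1},
      ∀ s t, eval ((svComplex a b).coneParam s t) M = s ^ (i.1 + 2) * (ρ.1.map t).prod :=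
    fun i => by
      have := i.2
      obtain ⟨M, h, h'⟩ := exists_eval_coneParam_eq_pow (i.1 + 1) ρ.1 ρ.2.1 (by omega)
      refine ⟨M, supported_mono (fun σ hσ => ?_) h, h'⟩
      simp only [Set.mem_ofPred_eq] at hσ ⊢
      omega
  choose M hM1 hM2 using hM
  -- The coefficients of `s ^ 0` and `s ^ 1` in the moment polynomial are `0` and `1`; the latter
  -- belongs to the coordinate `ρ` itself.
  refine ⟨∑ i, (momentPoly (r + 2)).coeff (i.1 + 2) • M i,
    sum_mem fun i _ => Subalgebra.smul_mem _ (hM1 i) _, fun s t => ?_⟩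
  have hdeg := natDegree_momentPoly_le (r + 2)
  rw [hr, Polynomial.eval_eq_sum_range' (n := r / 2 + 2) (by omega), Finset.sum_range_succ',
    Finset.sum_range_succ', zero_add, coeff_one_momentPoly, coeff_zero_momentPoly,
    Finset.sum_range, map_add, eval_X, map_sum, LabelledComplex.coneParam]
  simp only [smul_eval, hM2]
  rw [add_mul, add_mul, Finset.sum_mul]
  simp only [mul_assoc, pow_one, one_mul, zero_mul, add_zero]
  rw [add_comm]

/-- The index set of the coordinates of `ℂⁿ × ℂ^κ`, where `κ` is the set of simplices with at
least two elements. -/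
abbrev SVChart (a b : Fin k → ℕ) : Type :=
  Fin (∑ i, b i) ⊕ (svComplex a b).simplicesGeTwo

/-- The cardinality of the simplex belonging to a coordinate. -/
def chartRank : SVChart a b → ℕ := Sum.elim (fun _ => 1) fun σ => Multiset.card σ.1

/-- The point of `ℂⁿ × ℂ^κ` with coordinates `c` and `s t ^ σ`. -/
def chartParam (a b : Fin k → ℕ) (c : SVLabel b → ℂ) (s : ℂ) (t : SVLabel b → ℂ) :
    SVChart a b → ℂ :=
  Sum.elim (fun j => c (finSigmaFinEquiv.symm j)) ((svComplex a b).coneParam s t)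

/-- A moment of order at least two is its secant cumulant plus a polynomial in the means and the
secant cumulants of lower order. -/
theorem exists_eval_chartParam_eq (σ : (svComplex a b).simplicesGeTwo) :
    ∃ Q ∈ supported ℂ {j : SVChart a b | chartRank j < Multiset.card σ.1},
      ∀ c s t, chartParam a b c s t (Sum.inr σ) + eval (chartParam a b c s t) Q =
        twoPointMoment c s t σ.1 := by
  set S : Set (SVChart a b) := {j | chartRank j < Multiset.card σ.1}
  have hmean : ∀ τ : Multiset (SVLabel b), ∃ P ∈ supported ℂ S,
      ∀ c s t, eval (chartParam a b c s t) P = (τ.map c).prod := fun τ =>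
    ⟨(τ.map fun l => X (Sum.inl (finSigmaFinEquiv l))).prod,
      Subalgebra.multiset_prod_mem _ fun P hP => by
        obtain ⟨l, -, rfl⟩ := Multiset.mem_map.1 hP
        exact X_mem_supported.2 σ.2.2,
      fun c s t => by
        rw [map_multiset_prod, Multiset.map_map]
        simp [chartParam]⟩
  have hren : ∀ N ∈ supported ℂ {ρ : (svComplex a b).simplicesGeTwo |
      Multiset.card ρ.1 < Multiset.card σ.1},
      rename (Sum.inr : _ → SVChart a b) N ∈ supported ℂ S := fun N hN => by
    classical
    rw [mem_supported] at hN ⊢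
    intro j hj
    obtain ⟨ρ, hρ, rfl⟩ := Finset.mem_image.1 (vars_rename _ _ hj)
    exact hN hρ
  have heval : ∀ (N : MvPolynomial (svComplex a b).simplicesGeTwo ℂ) c s t,
      eval (chartParam a b c s t) (rename Sum.inr N) =
        eval ((svComplex a b).coneParam s t) N := fun N c s t => by
    rw [eval_rename]
    rfl
  have hcentral : ∀ ρ ≤ σ.1, Multiset.card ρ < Multiset.card σ.1 → ∃ P ∈ supported ℂ S,
      ∀ c s t, eval (chartParam a b c s t) P =
        (momentPoly (Multiset.card ρ)).eval s * (ρ.map t).prod := fun ρ hρ hlt => by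
    obtain h | h | h : Multiset.card ρ = 0 ∨ Multiset.card ρ = 1 ∨ 2 ≤ Multiset.card ρ := by omega
    · exact ⟨1, one_mem _, by simp [Multiset.card_eq_zero.1 h, momentPoly]⟩
    · exact ⟨0, zero_mem _, by simp [h, momentPoly]⟩
    · let ρ' : (svComplex a b).simplicesGeTwo := ⟨ρ, mem_simplices_of_le hρ σ.2.1, h⟩
      obtain ⟨N, hN, hN'⟩ := exists_eval_coneParam_eq_moment ρ'
      refine ⟨rename Sum.inr (X ρ' + N), hren _ (add_mem (X_mem_supported.2 hlt)
        (supported_mono (fun τ hτ => ?_) hN)), fun c s t => ?_⟩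
      · exact lt_trans hτ hlt
      · rw [heval, hN']
  obtain ⟨rest, hrest, hcard⟩ := exists_antidiagonal_eq_cons σ.1
  have hterm : ∀ q : Multiset (SVLabel b) × Multiset (SVLabel b), ∃ P, q ∈ rest →
      P ∈ supported ℂ S ∧ ∀ c s t, eval (chartParam a b c s t) P = (q.1.map c).prod *
        ((momentPoly (Multiset.card q.2)).eval s * (q.2.map t).prod) := fun q => by
    by_cases hq : q ∈ rest
    · have hadd : q.1 + q.2 = σ.1 := Multiset.mem_antidiagonal.1
        (hrest ▸ Multiset.mem_cons_of_mem hq)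
      obtain ⟨P, hP, hP'⟩ := hmean q.1
      obtain ⟨P₂, hP₂, hP₂'⟩ := hcentral q.2 (hadd ▸ Multiset.le_add_left _ _) (hcard q hq)
      exact ⟨P * P₂, fun _ => ⟨mul_mem hP hP₂, fun c s t => by rw [map_mul, hP', hP₂']⟩⟩
    · exact ⟨0, fun h => absurd h hq⟩
  choose P hP using hterm
  obtain ⟨N, hN, hN'⟩ := exists_eval_coneParam_eq_moment σ
  refine ⟨rename Sum.inr N + (rest.map P).sum, add_mem (hren N hN)
    (Subalgebra.multiset_sum_mem _ fun p hp => ?_), fun c s t => ?_⟩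
  · obtain ⟨q, hq, rfl⟩ := Multiset.mem_map.1 hp
    exact (hP q hq).1
  · -- The splitting with empty first part contributes the central moment of `σ`, that is, the
    -- coordinate `σ` and the polynomial `N`.
    have h1 := hN' s t
    rw [map_add, eval_X] at h1
    rw [map_add, heval, map_multiset_sum, Multiset.map_map, ← add_assoc, twoPointMoment, hrest,
      Multiset.map_cons, Multiset.sum_cons, Multiset.map_zero, Multiset.prod_zero, one_mul, ← h1]
    congr 2
    exact Multiset.map_congr rfl fun q hq => (hP q hq).2 c s t

end Cumulants

/-! ### Coordinates of the Segre-Veronese variety as words, and the action of shears -/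

section Words

variable {k : ℕ} {a b : Fin k → ℕ}

/-- A factorization of a monomial of multidegree `a` into ordered variables: a choice of one of the
variables `t_{i,0}, …, t_{i,b_i}` for each of the `a_i` places in the `i`-th block. -/
abbrev SVWord (a b : Fin k → ℕ) : Type := (q : (i : Fin k) × Fin (a i)) → Fin (b q.1 + 1)

/-- The multiset of labels of the variable `t_{i,l}`, which is empty for `l = 0`. -/
def letterLabels (i : Fin k) : Fin (b i + 1) → Multiset (SVLabel b) :=
  Fin.cases 0 fun j => {⟨i, j⟩}

/-- The multiset of labels in a word. -/
def wordLabels (w : SVWord a b) : Multiset (SVLabel b) := ∑ q, letterLabels q.1 (w q)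

theorem prod_map_sum {ι L : Type*} (s : Finset ι) (m : ι → Multiset L) (f : L → ℂ) :
    ((∑ q ∈ s, m q).map f).prod = ∏ q ∈ s, ((m q).map f).prod := by
  classical
  induction s using Finset.induction_on with
  | empty => simp
  | insert q s hq ih => rw [Finset.sum_insert hq, Finset.prod_insert hq, ← ih, Multiset.map_add,
      Multiset.prod_add]

theorem card_filter_letterLabels (i i' : Fin k) (l : Fin (b i + 1)) :
    Multiset.card ((letterLabels i l).filter fun x : SVLabel b => x.1 = i') =
      if i = i' ∧ l ≠ 0 then 1 else 0 := by
  refine Fin.cases ?_ (fun j => ?_) l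
  · simp [letterLabels]
  · by_cases h : i = i' <;> simp [letterLabels, Multiset.filter_singleton, h, Fin.succ_ne_zero]

theorem card_filter_wordLabels (w : SVWord a b) (i : Fin k) :
    Multiset.card ((wordLabels w).filter fun l => l.1 = i) =
      (Finset.univ.filter fun r : Fin (a i) => w ⟨i, r⟩ ≠ 0).card := by
  rw [← Multiset.countP_eq_card_filter, ← Multiset.coe_countPAddMonoidHom, wordLabels, map_sum]
  simp only [Multiset.coe_countPAddMonoidHom, Multiset.countP_eq_card_filter,
    card_filter_letterLabels]
  rw [Fintype.sum_sigma, Finset.sum_eq_single i]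
  · rw [Finset.card_filter]
    simp
  · intro i' _ hi'
    simp [hi']
  · simp

theorem wordLabels_mem (w : SVWord a b) : wordLabels w ∈ (svComplex a b).simplices :=
  (mem_simplices_iff _).2 fun i => by
    rw [card_filter_wordLabels]
    exact (Finset.card_filter_le _ _).trans (by simp)

theorem svCoord_wordLabels (t : (i : Fin k) → Fin (b i + 1) → ℂ) (w : SVWord a b) :
    svCoord a b t ⟨wordLabels w, wordLabels_mem w⟩ = ∏ q, t q.1 (w q) := by
  have h0 : ∀ q : (i : Fin k) × Fin (a i), t q.1 (w q) =
      (if w q = 0 then t q.1 0 else 1) *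
        ((letterLabels q.1 (w q)).map fun l : SVLabel b => t l.1 l.2.succ).prod := fun q => by
    refine Fin.cases ?_ (fun j => ?_) (w q)
    · simp [letterLabels]
    · simp [letterLabels, Fin.succ_ne_zero]
  rw [Finset.prod_congr rfl fun q _ => h0 q, Finset.prod_mul_distrib, ← prod_map_sum, svCoord]
  congr 1
  rw [Fintype.prod_sigma]
  refine Finset.prod_congr rfl fun i _ => ?_
  rw [card_filter_wordLabels, Finset.prod_ite, Finset.prod_const, one_pow, mul_one]
  refine Eq.trans ?_ (Finset.prod_const (t i 0)).symm
  congr 1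
  have := Finset.card_filter_add_card_filter_not (s := (Finset.univ : Finset (Fin (a i))))
    (fun r => w ⟨i, r⟩ = 0)
  simp only [Finset.card_univ, Fintype.card_fin] at this
  simp only [ne_eq]
  omega

theorem exists_map_univ_eq {α : Type*} (n : ℕ) (B : Multiset α) (hB : Multiset.card B = n) :
    ∃ g : Fin n → α, (Finset.univ : Finset (Fin n)).val.map g = B := by
  subst hB
  induction B using Quotient.inductionOn with
  | h l => exact ⟨l.get, by
      change (Finset.univ : Finset (Fin l.length)).val.map l.get = (l : Multiset α)
      rw [Fin.univ_val_map, List.ofFn_get]⟩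

/-- Every simplex is the multiset of labels of a word: list its labels in each block and fill the
remaining places with `0`. -/
theorem exists_wordLabels_eq (σ : SVIndex a b) : ∃ w : SVWord a b, wordLabels w = σ.1 := by
  have hσ := (mem_simplices_iff _).1 σ.2
  simp only [card_filter_block] at hσ
  let B : (i : Fin k) → Multiset (Fin (b i + 1)) := fun i =>
    (∑ j, σ.1.count ⟨i, j⟩ • {j.succ}) + (a i - ∑ j, σ.1.count ⟨i, j⟩) • {0}
  have hB : ∀ i, Multiset.card (B i) = a i := fun i => by
    have := hσ i
    simp only [B, Multiset.card_add, Multiset.card_sum, Multiset.card_nsmul,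
      Multiset.card_singleton, mul_one]
    omega
  choose g hg using fun i => exists_map_univ_eq (a i) (B i) (hB i)
  refine ⟨fun q => g q.1 q.2, ?_⟩
  rw [wordLabels, Fintype.sum_sigma]
  have hblock : ∀ i, ∑ r, letterLabels i (g i r) =
      ∑ j, σ.1.count ⟨i, j⟩ • ({⟨i, j⟩} : Multiset (SVLabel b)) := fun i => by
    change ((Finset.univ : Finset (Fin (a i))).val.map fun r => letterLabels i (g i r)).sum = _
    rw [← Function.comp_def, ← Multiset.map_map, hg]
    have h : ∀ m : Multiset (Fin (b i + 1)), (m.map (letterLabels (b := b) i)).sum =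
        (Multiset.sumAddMonoidHom.comp (Multiset.mapAddMonoidHom (letterLabels (b := b) i))) m :=
      fun _ => rfl
    rw [h]
    simp only [B, map_add, map_sum, map_nsmul]
    simp [letterLabels]
  simp only [hblock]
  ext l
  rw [← Fintype.sum_sigma' fun i j => σ.1.count ⟨i, j⟩ • ({⟨i, j⟩} : Multiset (SVLabel b)),
    Multiset.count_sum']
  simp [Multiset.count_nsmul, Multiset.count_singleton]

/-- A word with given labels. -/
def wordOf (σ : SVIndex a b) : SVWord a b := (exists_wordLabels_eq σ).choose

theorem wordLabels_wordOf (σ : SVIndex a b) : wordLabels (wordOf σ) = σ.1 :=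
  (exists_wordLabels_eq σ).choose_spec

theorem svCoord_eq_prod (t : (i : Fin k) → Fin (b i + 1) → ℂ) (σ : SVIndex a b) :
    svCoord a b t σ = ∏ q, t q.1 (wordOf σ q) := by
  rw [← svCoord_wordLabels]
  congr 1
  exact Subtype.ext (wordLabels_wordOf σ).symm

/-- The linear map on the ambient space induced by linear substitutions of the variables in each
block. -/
def blockAction (B : (i : Fin k) → Fin (b i + 1) → Fin (b i + 1) → ℂ) :
    (SVIndex a b → ℂ) →ₗ[ℂ] (SVIndex a b → ℂ) where
  toFun x σ := ∑ w : SVWord a b,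
    (∏ q, B q.1 (wordOf σ q) (w q)) * x ⟨wordLabels w, wordLabels_mem w⟩
  map_add' x y := by
    funext σ
    simp [mul_add, Finset.sum_add_distrib]
  map_smul' r x := by
    funext σ
    simp only [Pi.smul_apply, smul_eq_mul, RingHom.id_apply, Finset.mul_sum]
    exact Finset.sum_congr rfl fun w _ => by ring

theorem blockAction_svCoord (B : (i : Fin k) → Fin (b i + 1) → Fin (b i + 1) → ℂ)
    (t : (i : Fin k) → Fin (b i + 1) → ℂ) :
    blockAction B (svCoord a b t) = svCoord a b fun i l => ∑ l', B i l l' * t i l' := by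
  funext σ
  rw [svCoord_eq_prod, Finset.prod_univ_sum, Fintype.piFinset_univ]
  refine Finset.sum_congr rfl fun w _ => ?_
  rw [svCoord_wordLabels, ← Finset.prod_mul_distrib]

/-- The matrices of the substitution `t_{i,0} ↦ t_{i,0} + ∑_j c_{i,j} t_{i,j}`. -/
def shearMatrix (c : SVLabel b → ℂ) (i : Fin k) (l l' : Fin (b i + 1)) : ℂ :=
  if l = 0 then (Fin.cons 1 (fun j => c ⟨i, j⟩) : Fin (b i + 1) → ℂ) l'
  else if l = l' then 1 else 0

/-- The action on the ambient space of the substitution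
`t_{i,0} ↦ t_{i,0} + ∑_j c_{i,j} t_{i,j}`. -/
def shear (a : Fin k → ℕ) (c : SVLabel b → ℂ) : (SVIndex a b → ℂ) →ₗ[ℂ] (SVIndex a b → ℂ) :=
  blockAction (shearMatrix c)

/-- The substitution `t_{i,0} ↦ t_{i,0} + ∑_j c_{i,j} t_{i,j}`. -/
def shearVar (c : SVLabel b → ℂ) (t : (i : Fin k) → Fin (b i + 1) → ℂ) :
    (i : Fin k) → Fin (b i + 1) → ℂ :=
  fun i l => if l = 0 then t i 0 + ∑ j, c ⟨i, j⟩ * t i j.succ else t i l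

theorem shear_svCoord (c : SVLabel b → ℂ) (t : (i : Fin k) → Fin (b i + 1) → ℂ) :
    shear a c (svCoord a b t) = svCoord a b (shearVar c t) := by
  rw [shear, blockAction_svCoord]
  congr 1
  funext i l
  by_cases h : l = 0
  · simp [shearMatrix, shearVar, h, Fin.sum_univ_succ]
  · simp [shearMatrix, shearVar, h]

theorem shearVar_neg_shearVar (c : SVLabel b → ℂ) (t : (i : Fin k) → Fin (b i + 1) → ℂ) :
    shearVar (-c) (shearVar c t) = t := by
  funext i l
  by_cases h : l = 0
  · subst h
    simp [shearVar, Fin.succ_ne_zero]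
  · simp [shearVar, h]

theorem shearVar_ne_zero (c : SVLabel b → ℂ) {t : (i : Fin k) → Fin (b i + 1) → ℂ}
    (ht : ∀ i, t i ≠ 0) (i : Fin k) : shearVar c t i ≠ 0 := fun h => by
  refine ht i ?_
  rw [← shearVar_neg_shearVar c t]
  funext l
  have hl : ∀ l, shearVar c t i l = 0 := fun l => congrFun h l
  rw [shearVar]
  simp [hl]

/-- The point of the Segre-Veronese variety with affine coordinates `u`. -/
def veroneseVec (a : Fin k → ℕ) (u : SVLabel b → ℂ) : SVIndex a b → ℂ := fun σ => (σ.1.map u).prod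

theorem svCoord_cons_one (u : SVLabel b → ℂ) :
    svCoord a b (fun i => Fin.cons 1 fun j => u ⟨i, j⟩) = veroneseVec a u := by
  funext σ
  simp [svCoord, veroneseVec]

/-- The Segre-Veronese variety is not contained in a hyperplane. -/
theorem eq_zero_of_forall_veroneseVec (f : (SVIndex a b → ℂ) →ₗ[ℂ] ℂ)
    (h : ∀ u, f (veroneseVec a u) = 0) : f = 0 := by
  classical
  have := Fintype.ofFinite (SVIndex a b)
  have hP : (∑ σ : SVIndex a b, monomial (Multiset.toFinsupp σ.1) (f (Pi.single σ 1))) = 0 := by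
    refine MvPolynomial.funext fun u => ?_
    rw [map_zero, ← h u, map_sum, f.pi_apply_eq_sum_univ]
    refine Finset.sum_congr rfl fun σ _ => ?_
    rw [eval_monomial, Finsupp.prod_fintype _ _ (by simp), smul_eq_mul, mul_comm, veroneseVec,
      prod_map_eq_prod_pow_count]
    congr 2
    funext τ
    simp [Pi.single_apply, eq_comm]
  refine LinearMap.pi_ext' fun σ => LinearMap.ext_ring ?_
  have := congrArg (coeff (Multiset.toFinsupp σ.1)) hP
  rw [coeff_sum, Finset.sum_eq_single σ] at this
  · simpa using this
  · intro τ _ hτ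
    rw [coeff_monomial, if_neg]
    exact fun h => hτ (Subtype.ext (Multiset.toFinsupp.injective h))
  · simp

/-- The identity holds on the Segre-Veronese variety, which spans the ambient space. -/
theorem shear_neg_shear (c : SVLabel b → ℂ) (x : SVIndex a b → ℂ) :
    shear a (-c) (shear a c x) = x := by
  funext σ
  have := eq_zero_of_forall_veroneseVec
    (LinearMap.proj σ ∘ₗ (shear a (-c) ∘ₗ shear a c - LinearMap.id)) fun u => by
      rw [← svCoord_cons_one]
      simp [shear_svCoord, shearVar_neg_shearVar]
  have := LinearMap.congr_fun this x
  simpa [sub_eq_zero] using this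

theorem shear_shear_neg (c : SVLabel b → ℂ) (x : SVIndex a b → ℂ) :
    shear a c (shear a (-c) x) = x := by
  simpa using shear_neg_shear (-c) x

/-- The empty simplex. -/
def emptyIndex (a b : Fin k → ℕ) : SVIndex a b := ⟨0, (mem_simplices_iff _).2 (by simp)⟩

theorem wordOf_emptyIndex (q : (i : Fin k) × Fin (a i)) : wordOf (emptyIndex a b) q = 0 := by
  have h := wordLabels_wordOf (emptyIndex a b)
  have h2 : letterLabels q.1 (wordOf (emptyIndex a b) q) = 0 := by
    refine Multiset.le_zero.1 (le_of_le_of_eq ?_ h)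
    exact Finset.single_le_sum (f := fun q => letterLabels q.1 (wordOf (emptyIndex a b) q))
      (fun _ _ => zero_le) (Finset.mem_univ q)
  revert h2
  refine Fin.cases ?_ (fun j => ?_) (wordOf (emptyIndex a b) q)
  · simp
  · simp [letterLabels]

/-- Every point can be moved by a shear to the chart `x_∅ ≠ 0`, because the products of powers of
the linear forms `t_{i,0} + ∑_j c_{i,j} t_{i,j}` span the forms of multidegree `a`. -/
theorem exists_shear_emptyIndex_ne_zero {x : SVIndex a b → ℂ} (hx : x ≠ 0) :
    ∃ c, shear a c x (emptyIndex a b) ≠ 0 := by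
  classical
  by_contra! h
  refine hx (funext fun σ => ?_)
  let f : (SVIndex a b → ℂ) →ₗ[ℂ] ℂ := ∑ w : SVWord a b,
    x ⟨wordLabels w, wordLabels_mem w⟩ • LinearMap.proj ⟨wordLabels w, wordLabels_mem w⟩
  have hf : f = 0 := eq_zero_of_forall_veroneseVec f fun c => by
    rw [← h c, ← svCoord_cons_one]
    simp only [f, LinearMap.sum_apply, LinearMap.smul_apply, LinearMap.proj_apply, smul_eq_mul,
      svCoord_wordLabels]
    refine Finset.sum_congr rfl fun w _ => ?_
    simp [wordOf_emptyIndex, shearMatrix, mul_comm]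
  -- The coefficient of `c ^ σ` is `x_σ` times the positive number of words with labels `σ`.
  have h1 := LinearMap.congr_fun hf (Pi.single σ 1)
  have h2 : ∀ w : SVWord a b, x ⟨wordLabels w, wordLabels_mem w⟩ *
      (Pi.single σ 1 : SVIndex a b → ℂ) ⟨wordLabels w, wordLabels_mem w⟩ =
      if wordLabels w = σ.1 then x σ else 0 := fun w => by
    split_ifs with hw
    · obtain rfl : (⟨wordLabels w, wordLabels_mem w⟩ : SVIndex a b) = σ := Subtype.ext hw
      simp
    · rw [Pi.single_eq_of_ne (fun h => hw (congrArg Subtype.val h)), mul_zero]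
  simp only [f, LinearMap.sum_apply, LinearMap.smul_apply, LinearMap.proj_apply, smul_eq_mul, h2,
    LinearMap.zero_apply, ← Finset.sum_filter, Finset.sum_const, nsmul_eq_mul, mul_eq_zero,
    Nat.cast_eq_zero, Finset.card_eq_zero] at h1
  refine h1.resolve_left fun he => ?_
  have : wordOf σ ∈ Finset.univ.filter fun w => wordLabels w = σ.1 := by
    simp [wordLabels_wordOf]
  rw [he] at this
  simp at this

theorem svCoord_eq_smul_veroneseVec (t : (i : Fin k) → Fin (b i + 1) → ℂ) (ht : ∀ i, t i 0 ≠ 0) :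
    svCoord a b t =
      (∏ q : (i : Fin k) × Fin (a i), t q.1 0) •
        veroneseVec a fun l => t l.1 l.2.succ / t l.1 0 := by
  rw [← svCoord_cons_one]
  funext σ
  rw [Pi.smul_apply, svCoord_eq_prod, svCoord_eq_prod, smul_eq_mul, ← Finset.prod_mul_distrib]
  refine Finset.prod_congr rfl fun q _ => ?_
  refine Fin.cases ?_ (fun j => ?_) (wordOf σ q)
  · simp
  · simp [mul_div_cancel₀ _ (ht q.1)]

end Words

/-! ### The secant variety in terms of cumulants -/

section LinearForms

variable {ι : Type*} [Fintype ι] [DecidableEq ι]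

/-- The coordinates of a linear map, as linear forms. -/
def linForm (A : (ι → ℂ) →ₗ[ℂ] (ι → ℂ)) (i : ι) : MvPolynomial ι ℂ :=
  ∑ j, C (A (Pi.single j 1) i) * X j

theorem isHomogeneous_linForm (A : (ι → ℂ) →ₗ[ℂ] (ι → ℂ)) (i : ι) :
    (linForm A i).IsHomogeneous 1 :=
  IsHomogeneous.sum _ _ _ fun j _ => by
    simpa using (isHomogeneous_C ι (A (Pi.single j 1) i)).mul (isHomogeneous_X ℂ j)

theorem eval_linForm (A : (ι → ℂ) →ₗ[ℂ] (ι → ℂ)) (i : ι) (x : ι → ℂ) :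
    eval x (linForm A i) = A x i := by
  have h := congrFun (A.pi_apply_eq_sum_univ x) i
  rw [h, Finset.sum_apply, linForm, map_sum]
  refine Finset.sum_congr rfl fun j _ => ?_
  rw [map_mul, eval_C, eval_X, Pi.smul_apply, smul_eq_mul, mul_comm]
  congr 2
  refine congrFun (congrArg A (funext fun l => ?_)) i
  simp [Pi.single_apply, eq_comm]

end LinearForms

section Secant

variable {k : ℕ} {a b : Fin k → ℕ}

/-- The union of the secant lines of the Segre-Veronese variety. -/
def secantLines (a b : Fin k → ℕ) : Set (ℙ ℂ (SVIndex a b → ℂ)) :=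
  {p | ∃ x ∈ segreVeronese a b, ∃ y ∈ segreVeronese a b,
    p.submodule ≤ x.submodule ⊔ y.submodule}

theorem mk_mem_secantLines {v : SVIndex a b → ℂ} (hv : v ≠ 0) :
    Projectivization.mk ℂ v hv ∈ secantLines a b ↔
      ∃ t t' : (i : Fin k) → Fin (b i + 1) → ℂ, (∀ i, t i ≠ 0) ∧ (∀ i, t' i ≠ 0) ∧
        svCoord a b t ≠ 0 ∧ svCoord a b t' ≠ 0 ∧
        ∃ r r' : ℂ, r • svCoord a b t + r' • svCoord a b t' = v := by
  constructor
  · rintro ⟨_, ⟨t, ht, h, rfl⟩, _, ⟨t', ht', h', rfl⟩, hle⟩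
    rw [Projectivization.submodule_mk, Projectivization.submodule_mk,
      Projectivization.submodule_mk, Submodule.span_singleton_le_iff_mem,
      ← Submodule.span_insert, Submodule.mem_span_pair] at hle
    exact ⟨t, t', ht, ht', h, h', hle⟩
  · rintro ⟨t, t', ht, ht', h, h', hle⟩
    refine ⟨_, ⟨t, ht, h, rfl⟩, _, ⟨t', ht', h', rfl⟩, ?_⟩
    rwa [Projectivization.submodule_mk, Projectivization.submodule_mk,
      Projectivization.submodule_mk, Submodule.span_singleton_le_iff_mem,
      ← Submodule.span_insert, Submodule.mem_span_pair]

/-- The moments of a two-point law as a point of the ambient space. -/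
def momentVec (a : Fin k → ℕ) (c : SVLabel b → ℂ) (s : ℂ) (t : SVLabel b → ℂ) :
    SVIndex a b → ℂ := fun σ => twoPointMoment c s t σ.1

theorem momentVec_eq (c d : SVLabel b → ℂ) {p e s : ℂ} (he : e = 1 - 2 * p)
    (hs : s * e ^ 2 = p * (1 - p)) :
    momentVec a c s (fun l => e * d l) = (1 - p) • veroneseVec a (fun l => c l + -p * d l) +
      p • veroneseVec a (fun l => c l + (1 - p) * d l) :=
  funext fun σ => twoPointMoment_eq c d he hs σ.1

theorem continuous_momentVec (c t : SVLabel b → ℂ) :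
    Continuous fun s => momentVec a c s t := by
  refine continuous_pi fun σ => ?_
  simp only [momentVec, twoPointMoment]
  refine continuous_multiset_sum _ fun q _ => ?_
  exact continuous_const.mul ((Polynomial.continuous _).mul continuous_const)

theorem continuous_svCoord : Continuous (svCoord a b) := by
  refine continuous_pi fun σ => ?_
  simp only [svCoord_eq_prod]
  fun_prop

theorem veroneseVec_mem_secantLines {u u' : SVLabel b → ℂ} {r r' : ℂ}
    (h : r • veroneseVec a u + r' • veroneseVec a u' ≠ 0) :
    Projectivization.mk ℂ _ h ∈ secantLines a b := by
  have hne : ∀ u : SVLabel b → ℂ, veroneseVec a u ≠ 0 := fun u h0 => by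
    simpa [veroneseVec, emptyIndex] using congrFun h0 (emptyIndex a b)
  refine (mk_mem_secantLines h).2 ⟨fun i => Fin.cons 1 fun j => u ⟨i, j⟩,
    fun i => Fin.cons 1 fun j => u' ⟨i, j⟩, fun i h0 => ?_, fun i h0 => ?_, ?_, ?_, r, r', ?_⟩
  · simpa using congrFun h0 0
  · simpa using congrFun h0 0
  · rw [svCoord_cons_one]; exact hne u
  · rw [svCoord_cons_one]; exact hne u'
  · rw [svCoord_cons_one, svCoord_cons_one]

theorem momentVec_ne_zero (c : SVLabel b → ℂ) (s : ℂ) (t : SVLabel b → ℂ) :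
    momentVec a c s t ≠ 0 := fun h => by
  simpa [momentVec, emptyIndex, twoPointMoment_zero] using congrFun h (emptyIndex a b)

/-- A form vanishing on the secant lines vanishes at all moment vectors: for `s ≠ -1 / 4` one can
solve `s = p (1 - p) / (1 - 2p) ^ 2`, so that the moment vector lies on a secant line, and the
remaining value of `s` follows by continuity. -/
theorem eval_momentVec_eq_zero {d : ℕ} {F : MvPolynomial (SVIndex a b) ℂ}
    (hF : F.IsHomogeneous d) (h : ∀ q ∈ secantLines a b, eval q.rep F = 0)
    (c : SVLabel b → ℂ) (s : ℂ) (t : SVLabel b → ℂ) : eval (momentVec a c s t) F = 0 := by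
  refine eq_zero_of_forall_notMem_finite (f := fun s => eval (momentVec a c s t) F)
    ((MvPolynomial.continuous_eval F).comp (continuous_momentVec c t))
    (Set.finite_singleton (-1 / 4 : ℂ)) (fun s hs => ?_) s
  have hs' : 1 + 4 * s ≠ 0 := fun h0 => hs (by
    rw [Set.mem_singleton_iff]
    linear_combination h0 / 4)
  obtain ⟨e, he⟩ := IsAlgClosed.exists_pow_nat_eq (1 + 4 * s)⁻¹ (n := 2) two_pos
  have he2 : e ^ 2 * (1 + 4 * s) = 1 := by rw [he, inv_mul_cancel₀ hs']
  have he0 : e ≠ 0 := by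
    rintro rfl
    simp at he2
  have key := momentVec_eq (a := a) c (fun l => t l / e) (p := (1 - e) / 2) (e := e) (s := s)
    (by ring) (by linear_combination he2 / 4)
  have ht : (fun l => e * (t l / e)) = t := funext fun l => mul_div_cancel₀ _ he0
  rw [ht] at key
  have hne := momentVec_ne_zero (a := a) c s t
  rw [key] at hne
  have := h _ (veroneseVec_mem_secantLines hne)
  rw [eval_mk_rep_eq_zero hF, ← key] at this
  exact this

/-- A form vanishing at all moment vectors vanishes on the secant lines: a general point of a
general secant line is a multiple of a moment vector, and the others follow by continuity. -/
theorem eval_svCoord_eq_zero {d : ℕ} {F : MvPolynomial (SVIndex a b) ℂ}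
    (hF : F.IsHomogeneous d) (h : ∀ c s t, eval (momentVec a c s t) F = 0) (r r' : ℂ)
    (t t' : (i : Fin k) → Fin (b i + 1) → ℂ) :
    eval (r • svCoord a b t + r' • svCoord a b t') F = 0 := by
  have haff : ∀ (A B : ℂ) (u u' : SVLabel b → ℂ), A + B ≠ 0 → A - B ≠ 0 →
      eval (A • veroneseVec a u + B • veroneseVec a u') F = 0 := by
    intro A B u u' h1 h2
    -- The law with probabilities proportional to `A` and `B` at the points `u` and `u'`.
    have key := momentVec_eq (a := a)
      (fun l => (A * u l + B * u' l) / (A + B)) (fun l => u' l - u l) (p := B / (A + B))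
      (e := (A - B) / (A + B)) (s := A * B / (A - B) ^ 2) (by field_simp; ring)
      (by field_simp; ring)
    have hu : (fun l => (A * u l + B * u' l) / (A + B) + -(B / (A + B)) * (u' l - u l)) = u := by
      funext l
      field_simp
      ring
    have hu' : (fun l => (A * u l + B * u' l) / (A + B) + (1 - B / (A + B)) * (u' l - u l)) =
        u' := by
      funext l
      field_simp
      ring
    rw [hu, hu'] at key
    have hv : A • veroneseVec a u + B • veroneseVec a u' = (A + B) •
        ((1 - B / (A + B)) • veroneseVec a u + (B / (A + B)) • veroneseVec a u') := by
      rw [smul_add, smul_smul, smul_smul]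
      congr 2
      · field_simp; ring
      · field_simp
    rw [hv, ← key, eval_smul_of_isHomogeneous hF, h, mul_zero]
  have hgen : ∀ (r r' : ℂ) (t t' : (i : Fin k) → Fin (b i + 1) → ℂ), (∀ i, t i 0 ≠ 0) →
      (∀ i, t' i 0 ≠ 0) → eval (r • svCoord a b t + r' • svCoord a b t') F = 0 := by
    intro r r' t t' ht ht'
    rw [svCoord_eq_smul_veroneseVec t ht, svCoord_eq_smul_veroneseVec t' ht', smul_smul, smul_smul]
    set α := ∏ q : (i : Fin k) × Fin (a i), t q.1 0
    set β := ∏ q : (i : Fin k) × Fin (a i), t' q.1 0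
    have hα : α ≠ 0 := Finset.prod_ne_zero_iff.2 fun q _ => ht q.1
    refine eq_zero_of_forall_notMem_finite (f := fun r => eval ((r * α) • veroneseVec a
      (fun l => t l.1 l.2.succ / t l.1 0) + (r' * β) • veroneseVec a
      fun l => t' l.1 l.2.succ / t' l.1 0) F) ((MvPolynomial.continuous_eval F).comp ?_)
      (Set.toFinite {-(r' * β) / α, r' * β / α}) (fun r hr => haff _ _ _ _ ?_ ?_) r
    · fun_prop
    · intro h0
      refine hr (Or.inl ?_)
      rw [eq_div_iff hα]
      linear_combination h0
    · intro h0
      refine hr (Or.inr ?_)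
      rw [Set.mem_singleton_iff, eq_div_iff hα]
      linear_combination h0
  have hlim := eq_zero_of_forall_notMem_finite (f := fun z => eval
    (r • svCoord a b (fun i l => t i l + z) + r' • svCoord a b (fun i l => t' i l + z)) F)
    ((MvPolynomial.continuous_eval F).comp
      (((continuous_svCoord.comp (by fun_prop)).const_smul r).add
        ((continuous_svCoord.comp (by fun_prop)).const_smul r')))
    ((Set.finite_range fun i => -t i 0).union (Set.finite_range fun i => -t' i 0))
    (fun z hz => hgen _ _ _ _
      (fun i h0 => hz (Or.inl ⟨i, by linear_combination -h0⟩))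
      (fun i h0 => hz (Or.inr ⟨i, by linear_combination -h0⟩))) 0
  simpa using hlim

/-- The secant variety is the closure of the set of moment vectors of two-point laws. -/
theorem mk_mem_secantVariety_iff {v : SVIndex a b → ℂ} (hv : v ≠ 0) :
    Projectivization.mk ℂ v hv ∈ secantVariety (segreVeronese a b) ↔
      ∀ (d : ℕ) (F : MvPolynomial (SVIndex a b) ℂ), F.IsHomogeneous d →
        (∀ c s t, eval (momentVec a c s t) F = 0) → eval v F = 0 := by
  change _ ∈ projClosure (secantLines a b) ↔ _
  rw [mk_mem_projClosure]
  refine forall_congr' fun d => forall_congr' fun F => forall_congr' fun hF => ?_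
  have : (∀ q ∈ secantLines a b, eval q.rep F = 0) ↔ ∀ c s t, eval (momentVec a c s t) F = 0 := by
    refine ⟨eval_momentVec_eq_zero hF, fun h q hq => ?_⟩
    rw [← q.mk_rep] at hq
    obtain ⟨t, t', -, -, -, -, r, r', hr⟩ := (mk_mem_secantLines _).1 hq
    rw [← hr]
    exact eval_svCoord_eq_zero hF h r r' t t'
  rw [this]

theorem shear_ne_zero (c : SVLabel b → ℂ) {v : SVIndex a b → ℂ} (hv : v ≠ 0) :
    shear a c v ≠ 0 := fun h => hv (by rw [← shear_neg_shear c v, h, map_zero])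

/-- Shears preserve the secant variety, since they preserve the Segre-Veronese variety. -/
theorem shear_mem_secantVariety (c : SVLabel b → ℂ) {v : SVIndex a b → ℂ} (hv : v ≠ 0)
    (h : Projectivization.mk ℂ v hv ∈ secantVariety (segreVeronese a b)) :
    Projectivization.mk ℂ (shear a c v) (shear_ne_zero c hv) ∈
      secantVariety (segreVeronese a b) := by
  classical
  have := Fintype.ofFinite (SVIndex a b)
  change _ ∈ projClosure (secantLines a b) at h
  change _ ∈ projClosure (secantLines a b)
  rw [mk_mem_projClosure] at h ⊢
  intro d F hF hS
  have hG : ∀ x, eval x (bind₁ (linForm (shear a c)) F) = eval (shear a c x) F := fun x => by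
    rw [eval_bind₁_eq]
    simp only [eval_linForm]
  rw [← hG]
  refine h (1 * d) _ (hF.aeval _ fun i => isHomogeneous_linForm _ i) fun q hq => ?_
  rw [hG, ← eval_mk_rep_eq_zero hF (shear_ne_zero c q.rep_nonzero)]
  refine hS _ ?_
  rw [← q.mk_rep] at hq
  obtain ⟨t, t', ht, ht', h0, h0', r, r', hr⟩ := (mk_mem_secantLines _).1 hq
  refine (mk_mem_secantLines _).2 ⟨shearVar c t, shearVar c t', shearVar_ne_zero c ht,
    shearVar_ne_zero c ht', ?_, ?_, r, r', ?_⟩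
  · rw [← shear_svCoord]; exact shear_ne_zero c h0
  · rw [← shear_svCoord]; exact shear_ne_zero c h0'
  · rw [← hr, map_add, map_smul, map_smul, shear_svCoord, shear_svCoord]

end Secant

/-! ### The charts of the secant variety -/

section Charts

variable {k : ℕ} {a b : Fin k → ℕ}

/-- The simplex belonging to a coordinate of the chart. -/
def chartIndex (ha : ∀ i, 0 < a i) : SVChart a b → SVIndex a b :=
  Sum.elim (fun j => ⟨{finSigmaFinEquiv.symm j}, (mem_simplices_iff _).2 fun i => by
    rw [← Multiset.countP_eq_card_filter]
    exact (Multiset.countP_le_card _ _).trans (ha i)⟩) fun σ => ⟨σ.1, σ.2.1⟩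

theorem card_chartIndex (ha : ∀ i, 0 < a i) (j : SVChart a b) :
    Multiset.card (chartIndex ha j).1 = chartRank j := by
  rcases j with j | σ <;> simp [chartIndex, chartRank]

theorem chartIndex_injective (ha : ∀ i, 0 < a i) :
    Function.Injective (chartIndex (b := b) ha) := by
  intro j j' h
  have hr : chartRank j = chartRank j' := by
    rw [← card_chartIndex ha, ← card_chartIndex ha, h]
  have h1 := congrArg Subtype.val h
  rcases j with j | σ <;> rcases j' with j' | σ'
  · simp only [chartIndex, Sum.elim_inl, Multiset.singleton_inj,
      EmbeddingLike.apply_eq_iff_eq] at h1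
    rw [h1]
  · have := σ'.2.2
    simp only [chartRank, Sum.elim_inl, Sum.elim_inr] at hr
    omega
  · have := σ.2.2
    simp only [chartRank, Sum.elim_inl, Sum.elim_inr] at hr
    omega
  · have h2 : σ = σ' := Subtype.ext h1
    rw [h2]

theorem eq_emptyIndex_or_exists_chartIndex (ha : ∀ i, 0 < a i) (σ : SVIndex a b) :
    σ = emptyIndex a b ∨ ∃ j, chartIndex ha j = σ := by
  obtain h | h | h : Multiset.card σ.1 = 0 ∨ Multiset.card σ.1 = 1 ∨ 2 ≤ Multiset.card σ.1 := by
    omega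
  · exact Or.inl (Subtype.ext (Multiset.card_eq_zero.1 h))
  · obtain ⟨l, hl⟩ := Multiset.card_eq_one.1 h
    exact Or.inr ⟨Sum.inl (finSigmaFinEquiv l), Subtype.ext (by simp [chartIndex, hl])⟩
  · exact Or.inr ⟨Sum.inr ⟨σ.1, σ.2, h⟩, rfl⟩

theorem chartIndex_ne_emptyIndex (ha : ∀ i, 0 < a i) (j : SVChart a b) :
    chartIndex ha j ≠ emptyIndex a b := fun h => by
  have h1 := card_chartIndex ha j
  rw [h] at h1
  rcases j with j | σ
  · simp [emptyIndex, chartRank] at h1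
  · have := σ.2.2
    simp [emptyIndex, chartRank] at h1
    rw [← h1] at this
    simp at this

open Classical in
/-- The homogeneous coordinates of the point with given affine coordinates in the chart
`x_∅ ≠ 0`. -/
def chartPoly (ha : ∀ i, 0 < a i) (σ : SVIndex a b) : MvPolynomial (SVChart a b) ℂ :=
  if h : ∃ j, chartIndex ha j = σ then X h.choose else 1

theorem chartPoly_emptyIndex (ha : ∀ i, 0 < a i) : chartPoly ha (emptyIndex a b) = 1 :=
  dif_neg fun ⟨j, hj⟩ => chartIndex_ne_emptyIndex ha j hj

theorem chartPoly_chartIndex (ha : ∀ i, 0 < a i) (j : SVChart a b) :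
    chartPoly ha (chartIndex ha j) = X j := by
  have h : ∃ j', chartIndex ha j' = chartIndex ha j := ⟨j, rfl⟩
  rw [chartPoly, dif_pos h]
  congr 1
  exact chartIndex_injective ha h.choose_spec

/-- The point with affine coordinates `y` in the chart `x_∅ ≠ 0`. -/
def chartVec (ha : ∀ i, 0 < a i) (y : SVChart a b → ℂ) : SVIndex a b → ℂ :=
  fun σ => eval y (chartPoly ha σ)

theorem chartVec_emptyIndex (ha : ∀ i, 0 < a i) (y : SVChart a b → ℂ) :
    chartVec ha y (emptyIndex a b) = 1 := by simp [chartVec, chartPoly_emptyIndex]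

theorem chartVec_chartIndex (ha : ∀ i, 0 < a i) (y : SVChart a b → ℂ) (j : SVChart a b) :
    chartVec ha y (chartIndex ha j) = y j := by simp [chartVec, chartPoly_chartIndex]

theorem chartVec_ne_zero (ha : ∀ i, 0 < a i) (y : SVChart a b → ℂ) : chartVec ha y ≠ 0 :=
  fun h => by simpa [chartVec_emptyIndex] using congrFun h (emptyIndex a b)

theorem eq_chartVec (ha : ∀ i, 0 < a i) {x : SVIndex a b → ℂ} (h : x (emptyIndex a b) = 1) :
    x = chartVec ha fun j => x (chartIndex ha j) := by
  funext σ
  rcases eq_emptyIndex_or_exists_chartIndex ha σ with rfl | ⟨j, rfl⟩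
  · rw [h, chartVec_emptyIndex]
  · rw [chartVec_chartIndex]

/-- The polynomial change of coordinates between moments and secant cumulants: `Ψ` expresses the
moments by the means and the cumulants, and `Φ` is its inverse. -/
theorem exists_cumulant_change (ha : ∀ i, 0 < a i) :
    ∃ Ψ Φ : SVChart a b → MvPolynomial (SVChart a b) ℂ,
      (∀ z j, eval (fun i => eval z (Ψ i)) (Φ j) = z j) ∧
      (∀ y j, eval (fun i => eval y (Φ i)) (Ψ j) = y j) ∧
      ∀ c s t j, eval (chartParam a b c s t) (Ψ j) = momentVec a c s t (chartIndex ha j) := by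
  choose Q hQ hQ' using exists_eval_chartParam_eq (a := a) (b := b)
  let Q' : SVChart a b → MvPolynomial (SVChart a b) ℂ := Sum.elim 0 Q
  have hQ'_mem : ∀ j, Q' j ∈ supported ℂ {i | chartRank i < chartRank j} := by
    rintro (j | σ)
    · exact zero_mem _
    · exact hQ σ
  obtain ⟨Φ, hΦ⟩ := exists_inverse_of_triangular chartRank Q' hQ'_mem
  refine ⟨fun j => X j + Q' j, Φ, fun z j => ?_, fun y j => ?_, fun c s t j => ?_⟩
  · exact ((hΦ z fun i => eval z (X i + Q' i)).1 (fun i => by simp) j).symm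
  · rw [map_add, eval_X]
    exact ((hΦ (fun i => eval y (Φ i)) y).2 (fun _ => rfl) j).symm
  · rw [map_add, eval_X]
    rcases j with j | σ
    · simp [Q', chartParam, momentVec, chartIndex, twoPointMoment_singleton]
    · exact hQ' σ c s t

/-- `ℂⁿ` times the cone is the closure of the set of points with coordinates `c` and `s t ^ σ`. -/
theorem affineSpaceProd_svToricCone :
    affineSpaceProd (∑ i, b i) (svToricCone a b) =
      affineClosure {z | ∃ c s t, z = chartParam a b c s t} := by
  rw [svToricCone, LabelledComplex.affineCone_toricVariety, affineSpaceProd_affineClosure]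
  congr 1
  ext z
  constructor
  · rintro ⟨⟨s, t⟩, h⟩
    refine ⟨fun l => z (Sum.inl (finSigmaFinEquiv l)), s, t, ?_⟩
    funext j
    rcases j with j | σ
    · simp [chartParam]
    · exact (congrFun h σ).symm
  · rintro ⟨c, s, t, rfl⟩
    exact ⟨(s, t), rfl⟩

theorem momentVec_eq_chartVec (ha : ∀ i, 0 < a i) (c : SVLabel b → ℂ) (s : ℂ)
    (t : SVLabel b → ℂ) :
    momentVec a c s t = chartVec ha fun j => momentVec a c s t (chartIndex ha j) :=
  eq_chartVec ha (twoPointMoment_zero c s t)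

variable (ha : ∀ i, 0 < a i) {Ψ Φ : SVChart a b → MvPolynomial (SVChart a b) ℂ}

/-- The map from cumulants to moments sends `ℂⁿ` times the cone into the secant variety. -/
theorem chartVec_mem_secantVariety
    (hm : ∀ c s t j, eval (chartParam a b c s t) (Ψ j) = momentVec a c s t (chartIndex ha j))
    {z : SVChart a b → ℂ} (hz : z ∈ affineSpaceProd (∑ i, b i) (svToricCone a b)) :
    Projectivization.mk ℂ (chartVec ha fun j => eval z (Ψ j)) (chartVec_ne_zero ha _) ∈
      secantVariety (segreVeronese a b) := by
  refine (mk_mem_secantVariety_iff _).2 fun d F _ hF => ?_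
  have key : ∀ z, eval z (bind₁ Ψ (bind₁ (chartPoly ha) F)) =
      eval (chartVec ha fun j => eval z (Ψ j)) F := fun z => by
    rw [eval_bind₁_eq, eval_bind₁_eq]
    rfl
  rw [affineSpaceProd_svToricCone] at hz
  rw [← key]
  refine mem_affineClosure.1 hz _ ?_
  rintro _ ⟨c, s, t, rfl⟩
  rw [key]
  simp only [hm]
  rw [← momentVec_eq_chartVec]
  exact hF c s t

/-- The cumulants of a point of the secant variety in the chart `x_∅ ≠ 0` lie in `ℂⁿ` times the
cone. -/
theorem cumulants_mem_affineSpaceProd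
    (hΦ : ∀ z j, eval (fun i => eval z (Ψ i)) (Φ j) = z j)
    (hm : ∀ c s t j, eval (chartParam a b c s t) (Ψ j) = momentVec a c s t (chartIndex ha j))
    {v : SVIndex a b → ℂ} (hv : v ≠ 0) (hv0 : v (emptyIndex a b) ≠ 0)
    (h : Projectivization.mk ℂ v hv ∈ secantVariety (segreVeronese a b)) :
    (fun j => eval (fun i => v (chartIndex ha i) / v (emptyIndex a b)) (Φ j)) ∈
      affineSpaceProd (∑ i, b i) (svToricCone a b) := by
  rw [affineSpaceProd_svToricCone]
  refine mem_affineClosure.2 fun f hf => ?_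
  obtain ⟨d, F, hF, hFeq⟩ := exists_homogenization (bind₁ Φ f)
    (fun j => X (chartIndex ha j)) (fun _ => isHomogeneous_X ℂ _)
    (X (emptyIndex a b) : MvPolynomial (SVIndex a b) ℂ) (isHomogeneous_X ℂ _)
  simp only [eval_X, eval_bind₁_eq] at hFeq
  have hFv : eval v F = 0 := by
    refine (mk_mem_secantVariety_iff hv).1 h d F hF fun c s t => ?_
    have h1 : momentVec a c s t (emptyIndex a b) = 1 := twoPointMoment_zero c s t
    rw [hFeq _ (by rw [h1]; exact one_ne_zero), h1]
    simp only [div_one, ← hm, hΦ]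
    rw [hf _ ⟨c, s, t, rfl⟩, mul_zero]
  rw [hFeq v hv0] at hFv
  exact (mul_eq_zero.1 hFv).resolve_left (pow_ne_zero _ hv0)

/-- The part of the secant variety where the form `x_∅`, moved by a shear, does not vanish. -/
def secantChart (a : Fin k → ℕ) (c : SVLabel b → ℂ) : Set (ℙ ℂ (SVIndex a b → ℂ)) :=
  {p | p ∈ secantVariety (segreVeronese a b) ∧ shear a c p.rep (emptyIndex a b) ≠ 0}

/-- Moving by the shear to the chart `x_∅ ≠ 0` and passing to secant cumulants identifies each of
these open sets with `ℂⁿ` times the cone. -/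
theorem isIsomorphicToAffine_secantChart (ha : ∀ i, 0 < a i) (c : SVLabel b → ℂ) :
    IsIsomorphicToAffine (secantChart a c)
      (affineSpaceProd (∑ i, b i) (svToricCone a b)) := by
  classical
  have := Fintype.ofFinite (SVIndex a b)
  obtain ⟨Ψ, Φ, hΦΨ, hΨΦ, hm⟩ := exists_cumulant_change (a := a) (b := b) ha
  let y : (SVIndex a b → ℂ) → SVChart a b → ℂ := fun v j =>
    shear a c v (chartIndex ha j) / shear a c v (emptyIndex a b)
  let g : (SVChart a b → ℂ) → SVIndex a b → ℂ := fun z =>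
    shear a (-c) (chartVec ha fun j => eval z (Ψ j))
  have hg : ∀ z, g z ≠ 0 := fun z => shear_ne_zero _ (chartVec_ne_zero ha _)
  have hy_smul : ∀ (r : ℂˣ) v, y (r • v) = y v := fun r v => by
    funext j
    simp only [y, Units.smul_def, map_smul, Pi.smul_apply, smul_eq_mul]
    exact mul_div_mul_left _ _ r.ne_zero
  have hyg : ∀ z, y (g z) = fun j => eval z (Ψ j) := fun z => by
    funext j
    simp only [y, g, shear_shear_neg, chartVec_emptyIndex, chartVec_chartIndex, div_one]
  have hgy : ∀ v, shear a c v (emptyIndex a b) ≠ 0 → (shear a c v (emptyIndex a b))⁻¹ • v =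
      g fun j => eval (y v) (Φ j) := fun v hv => by
    simp only [g, hΨΦ]
    rw [← shear_neg_shear c ((shear a c v (emptyIndex a b))⁻¹ • v)]
    congr 1
    rw [map_smul, eq_chartVec ha (x := (shear a c v (emptyIndex a b))⁻¹ • shear a c v)
      (inv_mul_cancel₀ hv)]
    congr 1
    funext j
    simp only [y, Pi.smul_apply, smul_eq_mul]
    rw [div_eq_inv_mul]
  let φ : secantChart a c ≃ affineSpaceProd (∑ i, b i) (svToricCone a b) :=
    { toFun := fun p => ⟨fun j => eval (y p.1.rep) (Φ j),
        cumulants_mem_affineSpaceProd ha hΦΨ hm (shear_ne_zero c p.1.rep_nonzero) p.2.2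
          (shear_mem_secantVariety c p.1.rep_nonzero (by rw [p.1.mk_rep]; exact p.2.1))⟩
      invFun := fun z => ⟨Projectivization.mk ℂ (g z.1) (hg z.1),
        shear_mem_secantVariety (-c) _ (chartVec_mem_secantVariety ha hm z.2), by
          obtain ⟨r, hr⟩ := Projectivization.exists_smul_eq_mk_rep ℂ (g z.1) (hg z.1)
          rw [← hr, Units.smul_def, map_smul]
          simp only [g, shear_shear_neg, Pi.smul_apply, chartVec_emptyIndex, smul_eq_mul, mul_one]
          exact r.ne_zero⟩
      left_inv := fun p => Subtype.ext <| by
        refine Eq.trans ?_ p.1.mk_rep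
        rw [Projectivization.mk_eq_mk_iff']
        exact ⟨_, hgy p.1.rep p.2.2⟩
      right_inv := fun z => Subtype.ext <| by
        funext j
        obtain ⟨r, hr⟩ := Projectivization.exists_smul_eq_mk_rep ℂ (g z.1) (hg z.1)
        change eval (y (Projectivization.mk ℂ (g z.1) (hg z.1)).rep) (Φ j) = z.1 j
        rw [← hr, hy_smul, hyg, hΦΨ] }
  refine ⟨φ, fun j p => ?_, fun z => ?_⟩
  · obtain ⟨d, F, hF, hFeq⟩ := exists_homogenization (Φ j)
      (fun i => linForm (shear a c) (chartIndex ha i)) (fun _ => isHomogeneous_linForm _ _)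
      (linForm (shear a c) (emptyIndex a b)) (isHomogeneous_linForm _ _)
    simp only [eval_linForm] at hFeq
    refine ⟨d, F, linForm (shear a c) (emptyIndex a b) ^ d, hF, ?_, ?_, fun q _ => ?_⟩
    · simpa using (isHomogeneous_linForm (shear a c) (emptyIndex a b)).pow d
    · rw [map_pow, eval_linForm]
      exact pow_ne_zero _ p.2.2
    · rw [map_pow, eval_linForm, hFeq _ q.2.2,
        mul_div_cancel_left₀ _ (pow_ne_zero _ q.2.2)]
      rfl
  · have hG : ∀ z : SVChart a b → ℂ, (fun σ => eval z (bind₁ Ψ (bind₁ (chartPoly ha)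
        (linForm (shear a (-c)) σ)))) = g z := fun z => by
      funext σ
      rw [eval_bind₁_eq, eval_bind₁_eq, eval_linForm]
      rfl
    refine ⟨fun σ => bind₁ Ψ (bind₁ (chartPoly ha) (linForm (shear a (-c)) σ)), ?_,
      fun z' hz' => ?_⟩
    · rw [hG]
      exact hg z.1
    · simp only [hG]
      rfl

end Charts

end SecantToric

end

theorem proposition3p4 (k : ℕ) (hk : 0 < k) (a b : Fin k → ℕ)
    (ha : ∀ i, 0 < a i) (hb : ∀ i, 0 < b i) :
    SecantToric.IsAffineToricVariety (SecantToric.svToricCone a b) ∧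
    SecantToric.IsNormalAffineVariety (SecantToric.svToricCone a b) ∧
    SecantToric.IsAffineToricVariety
      (SecantToric.affineSpaceProd (∑ i, b i) (SecantToric.svToricCone a b)) ∧
    ∃ 𝒰 : Set (Set (ℙ ℂ (SecantToric.SVIndex a b → ℂ))),
      ⋃₀ 𝒰 = SecantToric.secantVariety (SecantToric.segreVeronese a b) ∧
      ∀ U ∈ 𝒰,
        SecantToric.IsZariskiOpenIn U
          (SecantToric.secantVariety (SecantToric.segreVeronese a b)) ∧
        SecantToric.IsIsomorphicToAffine U
          (SecantToric.affineSpaceProd (∑ i, b i) (SecantToric.svToricCone a b)) := by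
  classical
  have := Fintype.ofFinite (SecantToric.SVIndex a b)
  have htoric := (SecantToric.svComplex a b).isAffineToricVariety_cone
  refine ⟨htoric, SecantToric.isNormalAffineVariety_svToricCone a b, htoric.affineSpaceProd _,
    Set.range (SecantToric.secantChart a), ?_, ?_⟩
  · refine Set.Subset.antisymm (Set.sUnion_subset ?_) fun p hp => ?_
    · rintro _ ⟨c, rfl⟩ p hp
      exact hp.1
    · obtain ⟨c, hc⟩ := SecantToric.exists_shear_emptyIndex_ne_zero p.rep_nonzero
      exact ⟨_, ⟨c, rfl⟩, hp, hc⟩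
  · rintro _ ⟨c, rfl⟩
    refine ⟨?_, SecantToric.isIsomorphicToAffine_secantChart ha c⟩
    have := SecantToric.isZariskiOpenIn_ne_zero
      (Z := SecantToric.secantVariety (SecantToric.segreVeronese a b))
      (SecantToric.isHomogeneous_linForm (SecantToric.shear a c) (SecantToric.emptyIndex a b))
    simp only [SecantToric.eval_linForm] at this
    exact this
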